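/- Cubes $Q\subset\mathbb R^n$ have sides parallel to the axes; a weight is a non-negative locally integrable function $\sigma$ on $\mathbb{R}^n$, also regarded as the measure $\sigma(x)\,dx$, and $\langle\sigma\rangle_Q=\sigma(Q)/|Q|$. For $0<\alpha<n$ put $$M_\alpha f(x)=\sup_{Q\ni x}\frac{1}{|Q|^{1-\alpha/n}}\int_Q|f|,\qquad I_\alpha f(x)=\int_{\mathbb R^n}\frac{f(y)}{|y-x|^{n-\alpha}}\,dy,\qquad I_\alpha^\sigma f=I_\alpha(\sigma f).$$ Let $1<p\le q<\infty$, with conjugate exponents $p',q'$. Let $\varepsilon_q,\varepsilon_{p'}:(0,\infty)\to(0,\infty)$ be bounded below by positive constants, nonincreasing on $(0,1)$, nondecreasing on $(1,\infty)$, with $$\int_0^\infty\frac{dt}{t\,\varepsilon_q(t)^{1/q}}<\infty,\qquad \int_0^\infty\frac{dt}{t\,\varepsilon_{p'}(t)^{1/p'}}<\infty .$$ For weights $\sigma,w$ define $$\varrho_\sigma^{\alpha,p,q}(Q)=\frac{\int_Q M_\alpha(\mathbf 1_Q\sigma)^{q/p}\,dx}{\sigma(Q)^{q/p}},\qquad [[\sigma,w]]_{\alpha,p,q}=\sup_{Q}\left(|Q|^{\alpha/n}\langle\sigma\rangle_Q\right)^{q/p'}\langle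 w\rangle_Q\,\varrho_\sigma^{\alpha,p,q}(Q)\,\varepsilon_q\!\left(\varrho_\sigma^{\alpha,p,q}(Q)\right),$$ where the supremum is over all cubes; cubes with $\sigma(Q)=0$ or $w(Q)=0$ contribute $0$, and $t\,\varepsilon(t)$ is read as $\infty$ at $t=\infty$. Let $[[w,\sigma]]_{\alpha,q',p'}$ be defined in the same way, with $(\sigma,w,p,q,\varepsilon_q)$ replaced by $(w,\sigma,q',p',\varepsilon_{p'})$; that is, $$[[w,\sigma]]_{\alpha,q',p'}=\sup_{Q}\left(|Q|^{\alpha/n}\langle w\rangle_Q\right)^{p'/q}\langle \sigma\rangle_Q\,\varrho_w^{\alpha,q',p'}(Q)\,\varepsilon_{p'}\!\left(\varrho_w^{\alpha,q',p'}(Q)\right).$$ Then there are finite constants $C_{\alpha,n}$, depending only on $\alpha$ and $n$, and $K$, depending only on $p,q,\varepsilon_q,\varepsilon_{p'}$, such that for all weights $\sigma,w$ on $\mathbb R^n$ $$\left\|I_\alpha^\sigma:L^p(\sigma)\to L^q(w)\right\|\le K\,C_{\alpha,n}\left([[\sigma,w]]_{\alpha,p,q}^{1/q}+[[w,\sigma]]_{\alpha,q',p'}^{1/p'}\right).$$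 In particular, if the right-hand side is finite, then for every $f\in L^p(\sigma)$ the integral $I_\alpha(\sigma f)(x)$ converges absolutely for $w$-almost every $x$. -/

import Mathlib

open MeasureTheory Set
open scoped ENNReal NNReal

noncomputable section

namespace SepBump

variable {n : ℕ}

/-- The axis-parallel half-open cube with corner `a` and side length `l`. -/
def cube (a : EuclideanSpace ℝ (Fin n)) (l : ℝ) : Set (EuclideanSpace ℝ (Fin n)) :=
  {x | ∀ i, x i ∈ Ico (a i) (a i + l)}

/-- A weight: a non-negative, locally integrable function. -/
structure IsWeight (σ : EuclideanSpace ℝ (Fin n) → ℝ) : Prop where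
  nonneg : ∀ x, 0 ≤ σ x
  locallyIntegrable : LocallyIntegrable σ volume

/-- The measure `σ(x) dx`. -/
def weightMeasure (σ : EuclideanSpace ℝ (Fin n) → ℝ) : Measure (EuclideanSpace ℝ (Fin n)) :=
  volume.withDensity (fun x => ENNReal.ofReal (σ x))

/-- The average `⟨σ⟩_Q = σ(Q) / |Q|`. -/
def average (σ : EuclideanSpace ℝ (Fin n) → ℝ) (Q : Set (EuclideanSpace ℝ (Fin n))) : ℝ≥0∞ :=
  weightMeasure σ Q / volume Q

/-- The fractional maximal function: the supremum over all cubes `Q ∋ x` of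
`|Q|^(α/n - 1) ∫_Q |f|`. -/
def fracMax (α : ℝ) (f : EuclideanSpace ℝ (Fin n) → ℝ) (x : EuclideanSpace ℝ (Fin n)) : ℝ≥0∞ :=
  ⨆ (a : EuclideanSpace ℝ (Fin n)) (l : ℝ) (_ : 0 < l) (_ : x ∈ cube a l),
    (volume (cube a l)) ^ (α / n - 1) * ∫⁻ y in cube a l, ‖f y‖ₑ

/-- `ϱ_σ^{α,p,q}(Q) = ∫_Q M_α(1_Q σ)^{q/p} dx / σ(Q)^{q/p}`. -/
def varrho (α p q : ℝ) (σ : EuclideanSpace ℝ (Fin n) → ℝ)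
    (Q : Set (EuclideanSpace ℝ (Fin n))) : ℝ≥0∞ :=
  (∫⁻ x in Q, fracMax α (Q.indicator σ) x ^ (q / p)) / weightMeasure σ Q ^ (q / p)

/-- `t ↦ t ε(t)` on `[0, ∞]`, with value `0` at `0` and `∞` at `∞`. -/
def timesBump (ε : ℝ → ℝ) (t : ℝ≥0∞) : ℝ≥0∞ :=
  if t = ⊤ then ⊤ else t * ENNReal.ofReal (ε t.toReal)

/-- The separated bump `[[σ, w]]_{α,p,q}` formed with the function `ε`. In the products
`0 * ∞ = 0`, so that cubes with `σ(Q) = 0` or `w(Q) = 0` contribute `0`. -/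
def sepBump (α p q : ℝ) (ε : ℝ → ℝ) (σ w : EuclideanSpace ℝ (Fin n) → ℝ) : ℝ≥0∞ :=
  ⨆ (a : EuclideanSpace ℝ (Fin n)) (l : ℝ) (_ : 0 < l),
    ((volume (cube a l)) ^ (α / n) * average σ (cube a l)) ^ (q / p.conjExponent)
      * average w (cube a l) * timesBump ε (varrho α p q σ (cube a l))

/-- The integrand of the fractional integral. -/
def fracKernel (α : ℝ) (f : EuclideanSpace ℝ (Fin n) → ℂ) (x y : EuclideanSpace ℝ (Fin n)) : ℂ :=
  f y / ((‖y - x‖ ^ ((n : ℝ) - α) : ℝ) : ℂ)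

/-- The fractional integral `I_α f(x) = ∫ f(y) / |y - x|^(n - α) dy`. -/
def fracInt (α : ℝ) (f : EuclideanSpace ℝ (Fin n) → ℂ) (x : EuclideanSpace ℝ (Fin n)) : ℂ :=
  ∫ y, fracKernel α f x y

/-- `I_α^σ : f ↦ I_α(σ f)` is a bounded operator from `L^p(σ)` to `L^q(w)` with bound `N`:
for every `f ∈ L^p(σ)` the integral `I_α(σ f)(x)` converges absolutely for `w`-a.e. `x`,
the function it defines is `w`-measurable, and its `L^q(w)` norm is at most `N ‖f‖_{L^p(σ)}`. -/
def IsBound (α p q : ℝ) (σ w : EuclideanSpace ℝ (Fin n) → ℝ) (N : ℝ≥0∞) : Prop :=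
  ∀ f : EuclideanSpace ℝ (Fin n) → ℂ, MemLp f (ENNReal.ofReal p) (weightMeasure σ) →
    (∀ᵐ x ∂(weightMeasure w), Integrable (fracKernel α (fun y => (σ y : ℂ) * f y) x) volume) ∧
    AEStronglyMeasurable (fracInt α (fun y => (σ y : ℂ) * f y)) (weightMeasure w) ∧
    eLpNorm (fracInt α (fun y => (σ y : ℂ) * f y)) (ENNReal.ofReal q) (weightMeasure w) ≤
      N * eLpNorm f (ENNReal.ofReal p) (weightMeasure σ)

/-- The operator norm `‖I_α^σ : L^p(σ) → L^q(w)‖ ∈ [0, ∞]` (it is `∞` when there is no bound). -/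
def fracIntNorm (α p q : ℝ) (σ w : EuclideanSpace ℝ (Fin n) → ℝ) : ℝ≥0∞ :=
  sInf {N : ℝ≥0∞ | IsBound α p q σ w N}

/-- The admissible functions `ε` on `(0, ∞)` for the exponent `s`: bounded below by a positive
constant, nonincreasing on `(0,1)`, nondecreasing on `(1,∞)`, and
`∫_0^∞ dt / (t ε(t)^(1/s)) < ∞`. -/
structure IsBumpFunction (s : ℝ) (ε : ℝ → ℝ) : Prop where
  pos : ∃ m : ℝ, 0 < m ∧ ∀ t, 0 < t → m ≤ ε t
  antitoneOn : AntitoneOn ε (Ioo 0 1)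
  monotoneOn : MonotoneOn ε (Ioi 1)
  integrableOn : IntegrableOn (fun t : ℝ => 1 / (t * ε t ^ (1 / s))) (Ioi 0) volume

end SepBump

end

/-! One-third-shifted dyadic grids dominate `I_α` by finite positive dyadic operators
`∑ τ_Q σ(Q) ⟨f⟩_Q 1_Q` with `τ_Q = |Q|^(α/n - 1)`, with constants that do not depend on the finite
family. For such an operator the `L^p(σ) → L^q(w)` norm is controlled by Sawyer testing on the cubes
in both directions: split the cubes by comparing `⟨f⟩_Q^p σ(Q)` with `⟨g⟩_Q^q' w(Q)`, stop at the
cubes where the mean of `f` (respectively `g`) doubles, apply testing to each stopping cube and sum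
by the Carleson embedding theorem.

The testing condition follows from the bump. Slice the cubes by the dyadic size `2^r` of `ϱ_σ(Q)`.
Within a slice, the sum over the cubes below a cube where `σ(Q)/|Q|` has just doubled decays
geometrically in the side length, so only the sparse doubling cubes matter, and the bump condition
together with `∫_Q M_α(1_Q σ)^(q/p) = ϱ_σ(Q) σ(Q)^(q/p)` bounds the slice by `ε(2^r)^(-1/q)`. The
integrability of `1 / (t ε(t)^(1/q))` says that these bounds are summable in `r`. -/

noncomputable section

namespace SepBump

variable {X ι : Type*}

/-! ### Laminar families and records -/

/-- A finite family of sets is laminar if any two of its members are nested or disjoint. -/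
def Laminar (F : Finset (Set X)) : Prop :=
  ∀ P ∈ F, ∀ Q ∈ F, P ⊆ Q ∨ Q ⊆ P ∨ Disjoint P Q

lemma Laminar.mono {F G : Finset (Set X)} (hF : Laminar F) (h : G ⊆ F) : Laminar G :=
  fun P hP Q hQ => hF P (h hP) Q (h hQ)

lemma Laminar.subset_or_ssubset {F : Finset (Set X)} (hF : Laminar F) {P Q : Set X}
    (hP : P ∈ F) (hQ : Q ∈ F) {x : X} (hxP : x ∈ P) (hxQ : x ∈ Q) : P ⊆ Q ∨ Q ⊂ P := by
  rcases hF P hP Q hQ with h | h | h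
  · exact Or.inl h
  · exact (em (P ⊆ Q)).imp_right fun h' => ⟨h, h'⟩
  · exact absurd hxQ (disjoint_left.1 h hxP)

open Classical in
/-- The members `P` of `F` at which the level `κ` exceeds its values at all larger members: the
stopping sets of a corona decomposition governed by `κ`. -/
def records (F : Finset (Set X)) (κ : Set X → ℤ) : Finset (Set X) :=
  F.filter fun P => ∀ T ∈ F, P ⊂ T → κ T < κ P

section Records

variable {F : Finset (Set X)} {κ : Set X → ℤ} {P Q : Set X}

lemma mem_records : P ∈ records F κ ↔ P ∈ F ∧ ∀ T ∈ F, P ⊂ T → κ T < κ P := by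
  classical simp only [records, Finset.mem_filter]

lemma records_subset (F : Finset (Set X)) (κ : Set X → ℤ) : records F κ ⊆ F :=
  fun _ h => (mem_records.1 h).1

lemma exists_record_level_ge (κ : Set X → ℤ) (hQ : Q ∈ F) :
    ∃ P ∈ records F κ, Q ⊆ P ∧ κ Q ≤ κ P := by
  classical
  obtain ⟨P, -, hP⟩ := (F.filter fun P => Q ⊆ P ∧ κ Q ≤ κ P).exists_le_maximal
    (a := Q) (by simp [hQ])
  obtain ⟨hPF, hQP, hle⟩ := Finset.mem_filter.1 hP.1
  refine ⟨P, mem_records.2 ⟨hPF, fun T hT hPT => ?_⟩, hQP, hle⟩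
  by_contra! h
  exact hPT.2 (hP.2 (Finset.mem_filter.2 ⟨hT, hQP.trans hPT.1, hle.trans h⟩) hPT.1)

lemma records_level_anti (hP : P ∈ records F κ) (hQ : Q ∈ records F κ) (h : P ⊆ Q) :
    κ Q ≤ κ P := by
  rcases h.eq_or_ssubset with rfl | h
  · exact le_rfl
  · exact ((mem_records.1 hP).2 Q (records_subset F κ hQ) h).le

lemma records_level_injOn (hF : Laminar F) (κ : Set X → ℤ) (x : X) :
    InjOn κ {P | P ∈ records F κ ∧ x ∈ P} := by
  rintro P ⟨hP, hxP⟩ Q ⟨hQ, hxQ⟩ h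
  have hPF := records_subset F κ hP
  have hQF := records_subset F κ hQ
  rcases hF.subset_or_ssubset hPF hQF hxP hxQ with hPQ | hQP
  · rcases hPQ.eq_or_ssubset with hPQ | hPQ
    · exact hPQ
    · exact absurd h ((mem_records.1 hP).2 Q hQF hPQ).ne'
  · exact absurd h ((mem_records.1 hQ).2 P hPF hQP).ne

/-- The stopping parent of `Q`: for a nonempty member `Q` of a laminar family, the smallest record
containing `Q`. -/
def stoppingSet (F : Finset (Set X)) (κ : Set X → ℤ) (Q : Set X) : Set X :=
  ⋂₀ {P | P ∈ records F κ ∧ Q ⊆ P}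

lemma subset_stoppingSet : Q ⊆ stoppingSet F κ Q :=
  subset_sInter fun _ h => h.2

lemma stoppingSet_subset (hP : P ∈ records F κ) (h : Q ⊆ P) : stoppingSet F κ Q ⊆ P :=
  sInter_subset_of_mem ⟨hP, h⟩

lemma stoppingSet_mem_records (hF : Laminar F) (κ : Set X → ℤ) (hQ : Q ∈ F) (hne : Q.Nonempty) :
    stoppingSet F κ Q ∈ records F κ := by
  classical
  obtain ⟨x, hx⟩ := hne
  obtain ⟨T, hT, hQT, -⟩ := exists_record_level_ge κ hQ
  obtain ⟨P, -, hP⟩ := ((records F κ).filter (Q ⊆ ·)).exists_le_minimal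
    (a := T) (Finset.mem_filter.2 ⟨hT, hQT⟩)
  obtain ⟨hPR, hQP⟩ := Finset.mem_filter.1 hP.1
  suffices P ⊆ stoppingSet F κ Q from (this.antisymm (stoppingSet_subset hPR hQP)) ▸ hPR
  rintro y hy S ⟨hS, hQS⟩
  rcases hF.subset_or_ssubset (records_subset F κ hPR) (records_subset F κ hS)
    (hQP hx) (hQS hx) with h | h
  · exact h hy
  · exact hP.2 (Finset.mem_filter.2 ⟨hS, hQS⟩) h.1 hy

lemma level_le_level_stoppingSet (hF : Laminar F) (hQ : Q ∈ F) (hne : Q.Nonempty) :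
    κ Q ≤ κ (stoppingSet F κ Q) := by
  obtain ⟨P, hP, hQP, hle⟩ := exists_record_level_ge κ hQ
  exact hle.trans (records_level_anti (stoppingSet_mem_records hF κ hQ hne) hP
    (stoppingSet_subset hP hQP))

end Records

/-! ### Dyadic levels and geometric sums -/

lemma two_rpow_strictMono : StrictMono fun a : ℝ => (2 : ℝ≥0∞) ^ a := fun _ _ h =>
  ENNReal.rpow_lt_rpow_of_exponent_lt (by norm_num) (by norm_num) h

lemma two_rpow_add (a b : ℝ) : (2 : ℝ≥0∞) ^ (a + b) = 2 ^ a * 2 ^ b :=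
  ENNReal.rpow_add _ _ (by norm_num) (by norm_num)

lemma two_rpow_ne_zero (a : ℝ) : (2 : ℝ≥0∞) ^ a ≠ 0 := by simp

lemma two_rpow_ne_top (a : ℝ) : (2 : ℝ≥0∞) ^ a ≠ ⊤ := by simp [ENNReal.rpow_eq_top_iff]

lemma two_rpow_intCast (k : ℤ) : (2 : ℝ≥0∞) ^ (k : ℝ) = ENNReal.ofReal (2 ^ k) := by
  rw [← Real.rpow_intCast, ← ENNReal.ofReal_rpow_of_pos two_pos, ENNReal.ofReal_ofNat]

/-- The dyadic level of `x ∈ (0, ∞)`: the integer `k` with `2 ^ k ≤ x < 2 ^ (k + 1)`. -/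
def level (x : ℝ≥0∞) : ℤ := Int.log 2 x.toReal

section Level

variable {x : ℝ≥0∞}

lemma two_rpow_level_le (h0 : x ≠ 0) (ht : x ≠ ⊤) : (2 : ℝ≥0∞) ^ (level x : ℝ) ≤ x := by
  rw [two_rpow_intCast, ENNReal.ofReal_le_iff_le_toReal ht]
  exact_mod_cast Int.zpow_log_le_self one_lt_two (ENNReal.toReal_pos h0 ht)

lemma lt_two_rpow_level_add_one (ht : x ≠ ⊤) : x < 2 ^ ((level x : ℝ) + 1) := by
  have h := two_rpow_intCast (level x + 1)
  push_cast at h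
  rw [h, ENNReal.lt_ofReal_iff_toReal_lt ht]
  exact_mod_cast Int.lt_zpow_succ_log_self one_lt_two x.toReal

lemma le_level_of_two_rpow_le {k : ℤ} (ht : x ≠ ⊤) (h : (2 : ℝ≥0∞) ^ (k : ℝ) ≤ x) :
    k ≤ level x := by
  have h' : (k : ℝ) < level x + 1 :=
    two_rpow_strictMono.lt_iff_lt.1 (h.trans_lt (lt_two_rpow_level_add_one ht))
  exact Int.lt_add_one_iff.1 (by exact_mod_cast h')

end Level

/-- The sum of the geometric series with ratio `2 ^ (-a)`. -/
def geomConst (a : ℝ) : ℝ≥0∞ := (1 - (2 : ℝ≥0∞) ^ (-a))⁻¹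

lemma geomConst_ne_top {a : ℝ} (ha : 0 < a) : geomConst a ≠ ⊤ := by
  rw [geomConst, Ne, ENNReal.inv_eq_top, tsub_eq_zero_iff_le, not_le]
  exact ENNReal.rpow_lt_one_of_one_lt_of_neg (by norm_num) (by linarith)

lemma geomConst_ne_zero (a : ℝ) : geomConst a ≠ 0 :=
  ENNReal.inv_ne_zero.2 (ENNReal.sub_ne_top ENNReal.one_ne_top)

section GeometricSums

variable {s : Finset ι} {κ : ι → ℤ}

lemma sum_two_rpow_le (hκ : InjOn κ s) (a : ℝ) {k₀ : ℤ} (h : ∀ i ∈ s, κ i ≤ k₀) :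
    ∑ i ∈ s, (2 : ℝ≥0∞) ^ ((κ i : ℝ) * a) ≤ 2 ^ ((k₀ : ℝ) * a) * geomConst a := by
  classical
  have key : ∀ i ∈ s, (2 : ℝ≥0∞) ^ ((κ i : ℝ) * a) =
      2 ^ ((k₀ : ℝ) * a) * ((2 : ℝ≥0∞) ^ (-a)) ^ (k₀ - κ i).toNat := by
    intro i hi
    have hcast : (((k₀ - κ i).toNat : ℕ) : ℝ) = (k₀ : ℝ) - κ i := by
      exact_mod_cast Int.toNat_of_nonneg (sub_nonneg.2 (h i hi))
    rw [← ENNReal.rpow_natCast, ← ENNReal.rpow_mul, ← two_rpow_add, hcast]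
    ring_nf
  have hinj : InjOn (fun i => (k₀ - κ i).toNat) s := by
    intro i hi j hj hij
    have := h i hi
    have := h j hj
    exact hκ hi hj (by dsimp only at hij; omega)
  rw [Finset.sum_congr rfl key, ← Finset.mul_sum, geomConst, ← ENNReal.tsum_geometric,
    ← Finset.sum_image (f := fun m : ℕ => ((2 : ℝ≥0∞) ^ (-a)) ^ m) hinj]
  gcongr
  exact ENNReal.sum_le_tsum _

lemma sum_two_rpow_neg_le (hκ : InjOn κ s) (a : ℝ) {k₀ : ℤ} (h : ∀ i ∈ s, k₀ ≤ κ i) :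
    ∑ i ∈ s, (2 : ℝ≥0∞) ^ (-(κ i : ℝ) * a) ≤ 2 ^ (-(k₀ : ℝ) * a) * geomConst a := by
  simpa using sum_two_rpow_le (κ := fun i => -κ i)
    (fun i hi j hj hij => hκ hi hj (neg_injective hij)) a (fun i hi => neg_le_neg (h i hi))

lemma sum_two_rpow_le_rpow (hκ : InjOn κ s) {a : ℝ} (ha : 0 < a) {y : ℝ≥0∞}
    (h : ∀ i ∈ s, (2 : ℝ≥0∞) ^ (κ i : ℝ) ≤ y) :
    ∑ i ∈ s, (2 : ℝ≥0∞) ^ ((κ i : ℝ) * a) ≤ geomConst a * y ^ a := by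
  rcases s.eq_empty_or_nonempty with rfl | ⟨i, hi⟩
  · simp
  rcases eq_or_ne y ⊤ with rfl | hy
  · simp [ENNReal.top_rpow_of_pos ha, ENNReal.mul_top (geomConst_ne_zero a)]
  have hy0 : y ≠ 0 := fun h0 => two_rpow_ne_zero _ (le_zero_iff.1 (h0 ▸ h i hi))
  calc ∑ i ∈ s, (2 : ℝ≥0∞) ^ ((κ i : ℝ) * a)
      ≤ 2 ^ ((level y : ℝ) * a) * geomConst a :=
        sum_two_rpow_le hκ a fun i hi => le_level_of_two_rpow_le hy (h i hi)
    _ = geomConst a * (2 ^ (level y : ℝ)) ^ a := by rw [ENNReal.rpow_mul, mul_comm]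
    _ ≤ geomConst a * y ^ a := by gcongr; exact two_rpow_level_le hy0 hy

end GeometricSums

/-! ### Densities and the Carleson embedding -/

section Carleson

variable [MeasurableSpace X]

/-- Every member of `F` has positive and finite `μ`-measure. -/
def Nondegenerate (F : Finset (Set X)) (μ : Measure X) : Prop :=
  ∀ Q ∈ F, μ Q ≠ 0 ∧ μ Q ≠ ⊤

lemma Nondegenerate.mono {F G : Finset (Set X)} {μ : Measure X} (hF : Nondegenerate F μ)
    (h : G ⊆ F) : Nondegenerate G μ :=
  fun Q hQ => hF Q (h hQ)

lemma Nondegenerate.nonempty {F : Finset (Set X)} {μ : Measure X} (hF : Nondegenerate F μ)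
    {Q : Set X} (hQ : Q ∈ F) : Q.Nonempty :=
  nonempty_of_measure_ne_zero (hF Q hQ).1

/-- The average density `ν Q / μ Q` of `ν` with respect to `μ` on `Q`. For `ν = f dμ` this is the
`μ`-mean of `f` over `Q`. -/
def density (μ ν : Measure X) (Q : Set X) : ℝ≥0∞ := ν Q / μ Q

/-- The dyadic level of the density: the integer `k` with `2 ^ k ≤ ν Q / μ Q < 2 ^ (k + 1)`. -/
def densityLevel (μ ν : Measure X) (Q : Set X) : ℤ := level (density μ ν Q)

section Density

variable {F : Finset (Set X)} {μ ν : Measure X} {Q : Set X}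

lemma Nondegenerate.density_mul (hμ : Nondegenerate F μ) (hQ : Q ∈ F) :
    density μ ν Q * μ Q = ν Q :=
  ENNReal.div_mul_cancel (hμ Q hQ).1 (hμ Q hQ).2

lemma Nondegenerate.two_rpow_densityLevel_le (hμ : Nondegenerate F μ) (hν : Nondegenerate F ν)
    (hQ : Q ∈ F) : (2 : ℝ≥0∞) ^ (densityLevel μ ν Q : ℝ) ≤ density μ ν Q :=
  two_rpow_level_le (ENNReal.div_ne_zero.2 ⟨(hν Q hQ).1, (hμ Q hQ).2⟩)
    (ENNReal.div_ne_top (hν Q hQ).2 (hμ Q hQ).1)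

lemma Nondegenerate.density_le_two_rpow (hμ : Nondegenerate F μ) (hν : Nondegenerate F ν)
    (hQ : Q ∈ F) : density μ ν Q ≤ 2 ^ ((densityLevel μ ν Q : ℝ) + 1) :=
  (lt_two_rpow_level_add_one (ENNReal.div_ne_top (hν Q hQ).2 (hμ Q hQ).1)).le

lemma Nondegenerate.two_rpow_densityLevel_mul_le (hμ : Nondegenerate F μ)
    (hν : Nondegenerate F ν) (hQ : Q ∈ F) :
    (2 : ℝ≥0∞) ^ (densityLevel μ ν Q : ℝ) * μ Q ≤ ν Q := by
  rw [← hμ.density_mul (ν := ν) hQ]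
  gcongr
  exact hμ.two_rpow_densityLevel_le hν hQ

lemma Nondegenerate.le_two_rpow_mul (hμ : Nondegenerate F μ) (hν : Nondegenerate F ν)
    (hQ : Q ∈ F) : ν Q ≤ 2 ^ ((densityLevel μ ν Q : ℝ) + 1) * μ Q := by
  rw [← hμ.density_mul (ν := ν) hQ]
  gcongr
  exact hμ.density_le_two_rpow hν hQ

end Density

lemma rpow_eq_rpow_sub_one_mul (x : ℝ≥0∞) {p : ℝ} (hp : 1 ≤ p) :
    x ^ p = x ^ (p - 1) * x := by
  conv_lhs => rw [← sub_add_cancel p 1,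
    ENNReal.rpow_add_of_nonneg _ _ (sub_nonneg.2 hp) zero_le_one, ENNReal.rpow_one]

lemma withDensity_le_two_mul_setLIntegral {σ : Measure X} {f : X → ℝ≥0∞} (hf : Measurable f)
    {Q : Set X} (hQ : MeasurableSet Q) (hft : σ.withDensity f Q ≠ ⊤) {t : ℝ≥0∞}
    (ht : 2 * t * σ Q ≤ σ.withDensity f Q) :
    σ.withDensity f Q ≤ 2 * ∫⁻ x in Q ∩ {x | t < f x}, f x ∂σ := by
  set A := σ.withDensity f Q with hA
  set B := ∫⁻ x in Q ∩ {x | t < f x}, f x ∂σ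
  have hlow : ∫⁻ x in Q \ {x | t < f x}, f x ∂σ ≤ t * σ Q :=
    calc ∫⁻ x in Q \ {x | t < f x}, f x ∂σ ≤ ∫⁻ _ in Q \ {x | t < f x}, t ∂σ :=
          setLIntegral_mono measurable_const fun x hx => not_lt.1 hx.2
      _ ≤ t * σ Q := by
          rw [setLIntegral_const]
          gcongr
          exact sdiff_subset
  have hAB : A ≤ B + t * σ Q := by
    rw [hA, withDensity_apply _ hQ, ← lintegral_inter_add_sdiff f Q
      (measurableSet_lt measurable_const hf)]
    gcongr
  refine (ENNReal.add_le_add_iff_right hft).1 ?_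
  calc A + A ≤ (B + t * σ Q) + (B + t * σ Q) := add_le_add hAB hAB
    _ = 2 * B + 2 * t * σ Q := by ring
    _ ≤ 2 * B + A := by gcongr

lemma density_rpow_mul_le {F : Finset (Set X)} {σ : Measure X} {f : X → ℝ≥0∞}
    (hf : Measurable f) (hσ : Nondegenerate F σ) (hσf : Nondegenerate F (σ.withDensity f))
    {p : ℝ} (hp : 1 ≤ p) {P : Set X} (hP : P ∈ F) (hPm : MeasurableSet P) :
    density σ (σ.withDensity f) P ^ p * σ P ≤
      2 ^ (((densityLevel σ (σ.withDensity f) P : ℝ) + 1) * (p - 1)) *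
        (2 * ∫⁻ x in P ∩ {x | 2 ^ ((densityLevel σ (σ.withDensity f) P : ℝ) - 1) < f x},
          f x ∂σ) := by
  rw [rpow_eq_rpow_sub_one_mul _ hp, mul_assoc, hσ.density_mul hP, ENNReal.rpow_mul]
  gcongr ?_ * ?_
  · exact ENNReal.rpow_le_rpow (hσ.density_le_two_rpow hσf hP) (sub_nonneg.2 hp)
  · refine withDensity_le_two_mul_setLIntegral hf hPm (hσf P hP).2 ?_
    have hhalf (k : ℝ) : 2 * (2 : ℝ≥0∞) ^ (k - 1) = 2 ^ k := by
      rw [mul_comm]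
      simpa using (two_rpow_add (k - 1) 1).symm
    rw [hhalf]
    exact hσ.two_rpow_densityLevel_mul_le hσf hP

omit [MeasurableSpace X] in
lemma sum_indicator_two_rpow_le {R : Finset (Set X)} {κ : Set X → ℤ} {x : X}
    (hκ : InjOn κ {P | P ∈ R ∧ x ∈ P}) {a : ℝ} (ha : 0 < a) (f : X → ℝ≥0∞) :
    ∑ P ∈ R, (P ∩ {x | 2 ^ ((κ P : ℝ) - 1) < f x}).indicator
      (fun _ => (2 : ℝ≥0∞) ^ (((κ P : ℝ) + 1) * a)) x ≤
      2 ^ (2 * a) * geomConst a * f x ^ a := by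
  classical
  set E : Set X → Set X := fun P => P ∩ {x | 2 ^ ((κ P : ℝ) - 1) < f x}
  have hinj : InjOn (fun P => κ P - 1) (R.filter (x ∈ E ·)) := by
    intro P hP Q hQ h
    simp only [Finset.coe_filter, mem_ofPred_eq] at hP hQ
    exact hκ ⟨hP.1, hP.2.1⟩ ⟨hQ.1, hQ.2.1⟩ (sub_left_injective h)
  calc ∑ P ∈ R, (E P).indicator (fun _ => (2 : ℝ≥0∞) ^ (((κ P : ℝ) + 1) * a)) x
      = 2 ^ (2 * a) * ∑ P ∈ R.filter (x ∈ E ·), 2 ^ (((κ P - 1 : ℤ) : ℝ) * a) := by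
        rw [Finset.mul_sum, Finset.sum_filter]
        refine Finset.sum_congr rfl fun P _ => ?_
        rw [indicator_apply, ← two_rpow_add]
        push_cast
        ring_nf
    _ ≤ 2 ^ (2 * a) * (geomConst a * f x ^ a) := by
        gcongr
        refine sum_two_rpow_le_rpow hinj ha fun P hP => ?_
        push_cast
        exact (Finset.mem_filter.1 hP).2.2.le
    _ = _ := (mul_assoc _ _ _).symm

/-- The constant in the Carleson embedding over records of the mean. -/
def carlesonConst (p : ℝ) : ℝ≥0∞ := 2 * (2 ^ (2 * (p - 1)) * geomConst (p - 1))

lemma carlesonConst_ne_top {p : ℝ} (hp : 1 < p) : carlesonConst p ≠ ⊤ :=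
  ENNReal.mul_ne_top ENNReal.ofNat_ne_top
    (ENNReal.mul_ne_top (two_rpow_ne_top _) (geomConst_ne_top (sub_pos.2 hp)))

theorem sum_records_density_rpow_le {F : Finset (Set X)} (hF : Laminar F)
    (hm : ∀ Q ∈ F, MeasurableSet Q) {σ : Measure X} (hσ : Nondegenerate F σ) {f : X → ℝ≥0∞}
    (hf : Measurable f) (hσf : Nondegenerate F (σ.withDensity f)) {p : ℝ} (hp : 1 < p) :
    ∑ P ∈ records F (densityLevel σ (σ.withDensity f)), density σ (σ.withDensity f) P ^ p * σ P ≤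
      carlesonConst p * ∫⁻ x, f x ^ p ∂σ := by
  set κ := densityLevel σ (σ.withDensity f)
  set R := records F κ
  have hRF : ∀ P ∈ R, P ∈ F := fun P hP => records_subset F κ hP
  set E : Set X → Set X := fun P => P ∩ {x | 2 ^ ((κ P : ℝ) - 1) < f x}
  have hEm : ∀ P ∈ R, MeasurableSet (E P) := fun P hP =>
    (hm P (hRF P hP)).inter (measurableSet_lt measurable_const hf)
  set c : Set X → ℝ≥0∞ := fun P => 2 ^ (((κ P : ℝ) + 1) * (p - 1))
  calc ∑ P ∈ R, density σ (σ.withDensity f) P ^ p * σ P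
      ≤ ∑ P ∈ R, c P * (2 * ∫⁻ x in E P, f x ∂σ) := Finset.sum_le_sum fun P hP =>
        density_rpow_mul_le hf hσ hσf hp.le (hRF P hP) (hm P (hRF P hP))
    _ = 2 * ∫⁻ x, ∑ P ∈ R, (E P).indicator (fun _ => c P) x * f x ∂σ := by
        have hterm : ∀ P ∈ R, Measurable fun x => (E P).indicator (fun _ => c P) x * f x :=
          fun P hP => (measurable_const.indicator (hEm P hP)).mul hf
        rw [lintegral_finsetSum _ hterm, Finset.mul_sum]
        refine Finset.sum_congr rfl fun P hP => ?_
        simp_rw [← indicator_mul_left]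
        rw [lintegral_indicator (hEm P hP), lintegral_const_mul _ hf, mul_left_comm]
    _ ≤ 2 * ∫⁻ x, 2 ^ (2 * (p - 1)) * geomConst (p - 1) * f x ^ p ∂σ := by
        gcongr with x
        rw [← Finset.sum_mul, rpow_eq_rpow_sub_one_mul (f x) hp.le, ← mul_assoc]
        gcongr
        exact sum_indicator_two_rpow_le (records_level_injOn hF κ x) (sub_pos.2 hp) f
    _ = carlesonConst p * ∫⁻ x, f x ^ p ∂σ := by
        rw [lintegral_const_mul _ (hf.pow_const p), carlesonConst]
        ring

end Carleson

/-! ### The corona projection -/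

lemma sum_ite_le_of_subsingleton {s : Finset ι} {c : ι → Prop} [DecidablePred c] (a : ℝ≥0∞)
    (h : ∀ i ∈ s, ∀ j ∈ s, c i → c j → i = j) : ∑ i ∈ s, (if c i then a else 0) ≤ a := by
  by_cases hc : ∃ i ∈ s, c i
  · obtain ⟨i, hi, hci⟩ := hc
    rw [Finset.sum_eq_single_of_mem i hi fun j hj hji =>
      if_neg fun hcj => hji (h j hj i hi hcj hci), if_pos hci]
  · push Not at hc
    rw [Finset.sum_eq_zero fun i hi => if_neg (hc i hi)]
    exact zero_le

lemma sum_rpow_le_rpow_sum (s : Finset ι) (b : ι → ℝ≥0∞) {r : ℝ} (hr : 1 ≤ r) :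
    ∑ i ∈ s, b i ^ r ≤ (∑ i ∈ s, b i) ^ r := by
  classical
  induction s using Finset.induction_on with
  | empty => simp
  | insert i s hi ih =>
    rw [Finset.sum_insert hi, Finset.sum_insert hi]
    exact (add_le_add le_rfl ih).trans (ENNReal.add_rpow_le_rpow_add _ _ hr)

open Classical in
/-- The maximal members of `R` strictly inside `P`. -/
def children (R : Finset (Set X)) (P : Set X) : Finset (Set X) :=
  R.filter fun S => Maximal (fun T => T ∈ R ∧ T ⊂ P) S

section Children

variable {R : Finset (Set X)} {P S T : Set X}

lemma mem_children : S ∈ children R P ↔ Maximal (fun T => T ∈ R ∧ T ⊂ P) S := by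
  classical
  simpa only [children, Finset.mem_filter] using and_iff_right_of_imp fun h => h.prop.1

lemma children_subset (R : Finset (Set X)) (P : Set X) : children R P ⊆ R :=
  fun _ hS => (mem_children.1 hS).prop.1

lemma exists_subset_mem_children (hS : S ∈ R) (h : S ⊂ P) : ∃ T ∈ children R P, S ⊆ T := by
  classical
  obtain ⟨T, hST, hT⟩ := (R.filter (· ⊂ P)).exists_le_maximal
    (a := S) (Finset.mem_filter.2 ⟨hS, h⟩)
  exact ⟨T, mem_children.2 (by simpa only [Finset.mem_filter] using hT), hST⟩

lemma Laminar.eq_of_mem_children (hR : Laminar R) (hS : S ∈ children R P)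
    (hT : T ∈ children R P) {x : X} (hxS : x ∈ S) (hxT : x ∈ T) : S = T := by
  rw [mem_children] at hS hT
  rcases hR.subset_or_ssubset hS.prop.1 hT.prop.1 hxS hxT with h | h
  · exact hS.eq_of_subset hT.prop h
  · exact (hT.eq_of_subset hS.prop h.1).symm

lemma Laminar.parent_unique (hR : Laminar R) (hP : P ∈ R) (hT : T ∈ R) (hne : S.Nonempty)
    (hSP : S ∈ children R P) (hST : S ∈ children R T) : P = T := by
  rw [mem_children] at hSP hST
  have key : ∀ {P T : Set X}, P ∈ R → Maximal (fun U => U ∈ R ∧ U ⊂ T) S → S ⊂ P → ¬ P ⊂ T :=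
    fun hP hST hSP hPT => hST.not_gt ⟨hP, hPT⟩ hSP
  obtain ⟨x, hx⟩ := hne
  rcases hR.subset_or_ssubset hP hT (hSP.prop.2.1 hx) (hST.prop.2.1 hx) with h | h
  · exact h.eq_of_not_ssubset (key hP hST hSP.prop.2)
  · exact absurd h (key hT hSP hST.prop.2)

/-- The part of `P` outside its children. -/
def core (R : Finset (Set X)) (P : Set X) : Set X := P \ ⋃ S ∈ children R P, S

lemma Laminar.eq_of_mem_core (hR : Laminar R) (hP : P ∈ R) (hS : S ∈ R) {x : X}
    (hxP : x ∈ core R P) (hxS : x ∈ core R S) : P = S := by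
  have key : ∀ {P S : Set X}, P ∈ R → x ∈ core R P → x ∈ core R S → ¬ P ⊂ S := by
    intro P S hP hxP hxS h
    obtain ⟨T, hT, hPT⟩ := exists_subset_mem_children hP h
    exact hxS.2 (mem_biUnion hT (hPT hxP.1))
  rcases hR.subset_or_ssubset hP hS hxP.1 hxS.1 with h | h
  · exact h.eq_of_not_ssubset (key hP hxP hxS)
  · exact absurd h (key hS hxS hxP)

lemma le_indicator_core_add_sum_children (g : X → ℝ≥0∞) {x : X} (hx : x ∈ P) :
    g x ≤ (core R P).indicator g x + ∑ S ∈ children R P, S.indicator g x := by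
  by_cases hc : x ∈ core R P
  · simp [hc]
  obtain ⟨S, hS, hxS⟩ : ∃ S ∈ children R P, x ∈ S := by
    by_contra! h
    exact hc ⟨hx, by simpa using h⟩
  calc g x = S.indicator g x := (indicator_of_mem hxS g).symm
    _ ≤ ∑ S ∈ children R P, S.indicator g x :=
      Finset.single_le_sum (f := fun S => S.indicator g x) (fun _ _ => zero_le) hS
    _ ≤ _ := le_add_self

end Children

variable [MeasurableSpace X]

section CoronaProj

variable {R : Finset (Set X)} {P : Set X} {w : Measure X} {g : X → ℝ≥0∞}

lemma measurableSet_core (hm : ∀ Q ∈ R, MeasurableSet Q) (hP : P ∈ R) :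
    MeasurableSet (core R P) :=
  (hm P hP).diff (Finset.measurableSet_biUnion _ fun S hS => hm S (children_subset R P hS))

/-- The corona projection of `g` at `P`: it equals `g` on the core of `P` and the `w`-mean of `g`
on each child of `P`. -/
def coronaProj (R : Finset (Set X)) (w : Measure X) (g : X → ℝ≥0∞) (P : Set X) (x : X) : ℝ≥0∞ :=
  (core R P).indicator g x +
    ∑ S ∈ children R P, S.indicator (fun _ => density w (w.withDensity g) S) x

lemma measurable_coronaProj (hm : ∀ Q ∈ R, MeasurableSet Q) (hP : P ∈ R) (hg : Measurable g) :
    Measurable (coronaProj R w g P) :=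
  (hg.indicator (measurableSet_core hm hP)).add (Finset.measurable_sum _ fun S hS =>
    measurable_const.indicator (hm S (children_subset R P hS)))

lemma withDensity_le_setLIntegral_coronaProj (hm : ∀ Q ∈ R, MeasurableSet Q) (hP : P ∈ R)
    (hw : Nondegenerate R w) (hg : Measurable g) {Q : Set X} (hQm : MeasurableSet Q)
    (hQP : Q ⊆ P) (hQ : ∀ S ∈ children R P, S ⊆ Q ∨ Disjoint S Q) :
    w.withDensity g Q ≤ ∫⁻ x in Q, coronaProj R w g P x ∂w := by
  have hSm : ∀ S ∈ children R P, MeasurableSet S := fun S hS => hm S (children_subset R P hS)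
  have hchild : ∀ S ∈ children R P, ∫⁻ x in Q, S.indicator g x ∂w ≤
      ∫⁻ x in Q, S.indicator (fun _ => density w (w.withDensity g) S) x ∂w := by
    intro S hS
    rw [lintegral_indicator (hSm S hS), lintegral_indicator (hSm S hS),
      Measure.restrict_restrict (hSm S hS)]
    rcases hQ S hS with h | h
    · rw [inter_eq_left.2 h, setLIntegral_const, hw.density_mul (children_subset R P hS),
        withDensity_apply _ (hSm S hS)]
    · simp [h.inter_eq]
  calc w.withDensity g Q
      ≤ ∫⁻ x in Q, ((core R P).indicator g x + ∑ S ∈ children R P, S.indicator g x) ∂w := by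
        rw [withDensity_apply _ hQm]
        exact setLIntegral_mono' hQm fun x hx => le_indicator_core_add_sum_children g (hQP hx)
    _ = ∫⁻ x in Q, (core R P).indicator g x ∂w +
          ∑ S ∈ children R P, ∫⁻ x in Q, S.indicator g x ∂w := by
        rw [lintegral_add_left (hg.indicator (measurableSet_core hm hP)),
          lintegral_finsetSum _ fun S hS => hg.indicator (hSm S hS)]
    _ ≤ ∫⁻ x in Q, (core R P).indicator g x ∂w + ∑ S ∈ children R P,
          ∫⁻ x in Q, S.indicator (fun _ => density w (w.withDensity g) S) x ∂w := by
        exact add_le_add le_rfl (Finset.sum_le_sum hchild)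
    _ = ∫⁻ x in Q, coronaProj R w g P x ∂w := by
        rw [← lintegral_finsetSum _ fun S hS => measurable_const.indicator (hSm S hS),
          ← lintegral_add_left (hg.indicator (measurableSet_core hm hP))]
        rfl

lemma coronaProj_rpow_le (hR : Laminar R) {r : ℝ} (hr : 0 < r) (x : X) :
    coronaProj R w g P x ^ r ≤ (core R P).indicator (fun x => g x ^ r) x +
      ∑ S ∈ children R P, S.indicator (fun _ => density w (w.withDensity g) S ^ r) x := by
  by_cases hcore : x ∈ core R P
  · have hzero : ∑ S ∈ children R P, S.indicator (fun _ => density w (w.withDensity g) S) x = 0 :=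
      Finset.sum_eq_zero fun S hS => indicator_of_notMem (fun hx => hcore.2 (mem_biUnion hS hx)) _
    simp [coronaProj, hcore, hzero]
  simp only [coronaProj, hcore, not_false_eq_true, indicator_of_notMem, zero_add]
  by_cases hchild : ∃ S ∈ children R P, x ∈ S
  · obtain ⟨S, hS, hxS⟩ := hchild
    have hother : ∀ T ∈ children R P, T ≠ S → x ∉ T := fun T hT hne hxT =>
      hne (hR.eq_of_mem_children hT hS hxT hxS)
    rw [Finset.sum_eq_single_of_mem S hS fun T hT hne => indicator_of_notMem (hother T hT hne) _,
      Finset.sum_eq_single_of_mem S hS fun T hT hne => indicator_of_notMem (hother T hT hne) _]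
    simp [hxS]
  · push Not at hchild
    rw [Finset.sum_eq_zero fun S hS => indicator_of_notMem (hchild S hS) _]
    simp [hr]

lemma lintegral_coronaProj_rpow_le (hR : Laminar R) (hm : ∀ Q ∈ R, MeasurableSet Q) (hP : P ∈ R)
    (hg : Measurable g) {r : ℝ} (hr : 0 < r) :
    ∫⁻ x, coronaProj R w g P x ^ r ∂w ≤ ∫⁻ x, (core R P).indicator (fun x => g x ^ r) x ∂w +
      ∑ S ∈ children R P, density w (w.withDensity g) S ^ r * w S := by
  have hSm : ∀ S ∈ children R P, MeasurableSet S := fun S hS => hm S (children_subset R P hS)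
  refine (lintegral_mono fun x => coronaProj_rpow_le hR hr x).trans_eq ?_
  rw [lintegral_add_left ((hg.pow_const r).indicator (measurableSet_core hm hP)),
    lintegral_finsetSum _ fun S hS => measurable_const.indicator (hSm S hS)]
  congr 1
  exact Finset.sum_congr rfl fun S hS => by rw [lintegral_indicator (hSm S hS), setLIntegral_const]

lemma sum_lintegral_coronaProj_rpow_le (hR : Laminar R) (hm : ∀ Q ∈ R, MeasurableSet Q)
    (hne : ∀ Q ∈ R, Q.Nonempty) (hg : Measurable g) {r : ℝ} (hr : 0 < r) :
    ∑ P ∈ R, ∫⁻ x, coronaProj R w g P x ^ r ∂w ≤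
      ∫⁻ x, g x ^ r ∂w + ∑ S ∈ R, density w (w.withDensity g) S ^ r * w S := by
  classical
  refine (Finset.sum_le_sum fun P hP => lintegral_coronaProj_rpow_le hR hm hP hg hr).trans ?_
  rw [Finset.sum_add_distrib]
  gcongr ?_ + ?_
  · rw [← lintegral_finsetSum _ fun P hP => (hg.pow_const r).indicator (measurableSet_core hm hP)]
    gcongr with x
    simp only [indicator_apply]
    exact sum_ite_le_of_subsingleton _ fun P hP S hS => hR.eq_of_mem_core hP hS
  · calc ∑ P ∈ R, ∑ S ∈ children R P, density w (w.withDensity g) S ^ r * w S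
        = ∑ S ∈ R, ∑ P ∈ R,
            if S ∈ children R P then density w (w.withDensity g) S ^ r * w S else 0 := by
          rw [Finset.sum_comm]
          refine Finset.sum_congr rfl fun P _ => ?_
          rw [← Finset.sum_filter, Finset.filter_mem_eq_inter,
            Finset.inter_eq_right.2 (children_subset R P)]
      _ ≤ ∑ S ∈ R, density w (w.withDensity g) S ^ r * w S := by
          gcongr with S hS
          exact sum_ite_le_of_subsingleton _ fun P hP T hT => hR.parent_unique hP hT (hne S hS)

end CoronaProj

/-! ### Positive dyadic operators and the two-weight testing theorem -/

/-- The positive dyadic operator `∑ τ_Q μ(Q) 1_Q`, applied to the measure `μ`. -/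
def dyadicOp (F : Finset (Set X)) (τ : Set X → ℝ≥0∞) (μ : Measure X) (x : X) : ℝ≥0∞ :=
  ∑ Q ∈ F, Q.indicator (fun _ => τ Q * μ Q) x

open Classical in
/-- The members of `F` contained in `R`. -/
def below (F : Finset (Set X)) (R : Set X) : Finset (Set X) := F.filter (· ⊆ R)

/-- Sawyer's testing condition with constant `T`: on each `R ∈ F` the part of the operator localized
to `R` maps `1_R`, as an element of `L^p(σ)`, to `L^q(w)` with norm at most `T`. -/
def Testing (F : Finset (Set X)) (τ : Set X → ℝ≥0∞) (σ w : Measure X) (p q : ℝ) (T : ℝ≥0∞) : Prop :=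
  ∀ R ∈ F, (∫⁻ x, dyadicOp (below F R) τ σ x ^ q ∂w) ^ (1 / q) ≤ T * σ R ^ (1 / p)

section DyadicOp

variable {F G : Finset (Set X)} {τ : Set X → ℝ≥0∞} {σ μ w : Measure X}

omit [MeasurableSpace X] in
lemma mem_below {Q R : Set X} : Q ∈ below F R ↔ Q ∈ F ∧ Q ⊆ R := by
  classical simp only [below, Finset.mem_filter]

omit [MeasurableSpace X] in
lemma below_subset (F : Finset (Set X)) (R : Set X) : below F R ⊆ F :=
  fun _ h => (mem_below.1 h).1

lemma dyadicOp_mono (h : F ⊆ G) (τ : Set X → ℝ≥0∞) (μ : Measure X) (x : X) :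
    dyadicOp F τ μ x ≤ dyadicOp G τ μ x :=
  Finset.sum_le_sum_of_subset h

lemma measurable_dyadicOp (hm : ∀ Q ∈ F, MeasurableSet Q) (τ : Set X → ℝ≥0∞) (μ : Measure X) :
    Measurable (dyadicOp F τ μ) :=
  Finset.measurable_sum _ fun Q hQ => measurable_const.indicator (hm Q hQ)

lemma lintegral_dyadicOp_mul (hm : ∀ Q ∈ F, MeasurableSet Q) {h : X → ℝ≥0∞} (hh : Measurable h) :
    ∫⁻ x, dyadicOp F τ μ x * h x ∂w = ∑ Q ∈ F, τ Q * μ Q * w.withDensity h Q := by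
  have hmeas : ∀ Q ∈ F, Measurable fun x => Q.indicator (fun _ => τ Q * μ Q) x * h x :=
    fun Q hQ => (measurable_const.indicator (hm Q hQ)).mul hh
  simp_rw [dyadicOp, Finset.sum_mul]
  rw [lintegral_finsetSum _ hmeas]
  refine Finset.sum_congr rfl fun Q hQ => ?_
  simp_rw [← indicator_mul_left]
  rw [lintegral_indicator (hm Q hQ), lintegral_const_mul _ hh, withDensity_apply _ (hm Q hQ)]

lemma Testing.mono {p q : ℝ} {T : ℝ≥0∞} (hT : Testing G τ σ w p q T) (h : F ⊆ G) (hq : 0 ≤ q) :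
    Testing F τ σ w p q T := by
  intro R hR
  refine le_trans ?_ (hT R (h hR))
  gcongr with x
  refine dyadicOp_mono (fun Q hQ => ?_) τ σ x
  exact mem_below.2 ⟨h (mem_below.1 hQ).1, (mem_below.1 hQ).2⟩

end DyadicOp

section Exponents

variable {p p' q q' : ℝ}

lemma holderConjugate_le_of_le (hp : p.HolderConjugate p') (hq : q.HolderConjugate q')
    (hpq : p ≤ q) : q' ≤ p' := by
  have hinv : q⁻¹ ≤ p⁻¹ := inv_anti₀ hp.pos hpq
  have h1 := hp.inv_add_inv_eq_one
  have h2 := hq.inv_add_inv_eq_one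
  exact (inv_le_inv₀ hp.symm.pos hq.symm.pos).1 (by linarith)

lemma rpow_eq_rpow_inv_mul_rpow_inv (hq : q.HolderConjugate q') (x : ℝ≥0∞) :
    x = x ^ (1 / q) * x ^ (1 / q') := by
  rw [← ENNReal.rpow_add_of_nonneg _ _ hq.one_div_nonneg hq.symm.one_div_nonneg, one_div, one_div,
    hq.inv_add_inv_eq_one, ENNReal.rpow_one]

lemma sum_rpow_mul_rpow_le (hp : p.HolderConjugate p') (hq : q.HolderConjugate q') (hpq : p ≤ q)
    (s : Finset ι) (a b : ι → ℝ≥0∞) :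
    ∑ i ∈ s, a i ^ (1 / p) * b i ^ (1 / q') ≤
      (∑ i ∈ s, a i) ^ (1 / p) * (∑ i ∈ s, b i) ^ (1 / q') := by
  have hr : 1 ≤ p' / q' := (one_le_div hq.symm.pos).2 (holderConjugate_le_of_le hp hq hpq)
  calc ∑ i ∈ s, a i ^ (1 / p) * b i ^ (1 / q')
      ≤ (∑ i ∈ s, (a i ^ (1 / p)) ^ p) ^ (1 / p) *
          (∑ i ∈ s, (b i ^ (1 / q')) ^ p') ^ (1 / p') :=
        ENNReal.inner_le_Lp_mul_Lq s _ _ hp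
    _ = (∑ i ∈ s, a i) ^ (1 / p) * (∑ i ∈ s, b i ^ (p' / q')) ^ (1 / p') := by
        simp only [← ENNReal.rpow_mul, one_div_mul_cancel hp.ne_zero, ENNReal.rpow_one,
          one_div_mul_eq_div]
    _ ≤ (∑ i ∈ s, a i) ^ (1 / p) * ((∑ i ∈ s, b i) ^ (p' / q')) ^ (1 / p') := by
        gcongr
        · exact hp.symm.one_div_nonneg
        · exact sum_rpow_le_rpow_sum s b hr
    _ = (∑ i ∈ s, a i) ^ (1 / p) * (∑ i ∈ s, b i) ^ (1 / q') := by
        rw [← ENNReal.rpow_mul, div_mul_div_comm, mul_one, mul_comm q', ← div_div,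
          div_self hp.symm.ne_zero]

lemma withDensity_le_lintegral_rpow_mul {σ : Measure X} (hp : p.HolderConjugate p')
    {f : X → ℝ≥0∞} (hf : Measurable f) {Q : Set X} (hQ : MeasurableSet Q) :
    σ.withDensity f Q ≤ (∫⁻ x, f x ^ p ∂σ) ^ (1 / p) * σ Q ^ (1 / p') := by
  have h := ENNReal.lintegral_mul_le_Lp_mul_Lq (σ.restrict Q) hp hf.aemeasurable
    (g := fun _ => 1) aemeasurable_const
  simp only [Pi.mul_apply, mul_one, ENNReal.one_rpow, lintegral_const, one_mul,
    Measure.restrict_apply_univ] at h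
  rw [withDensity_apply _ hQ]
  refine h.trans ?_
  gcongr
  · exact hp.one_div_nonneg
  · exact Measure.restrict_le_self

lemma withDensity_apply_ne_top {σ : Measure X} (hp : p.HolderConjugate p') {f : X → ℝ≥0∞}
    (hf : Measurable f) (hft : ∫⁻ x, f x ^ p ∂σ ≠ ⊤) {Q : Set X} (hQ : MeasurableSet Q)
    (hσQ : σ Q ≠ ⊤) : σ.withDensity f Q ≠ ⊤ :=
  ne_top_of_le_ne_top (ENNReal.mul_ne_top (ENNReal.rpow_ne_top_of_nonneg hp.one_div_nonneg hft)
    (ENNReal.rpow_ne_top_of_nonneg hp.symm.one_div_nonneg hσQ))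
    (withDensity_le_lintegral_rpow_mul hp hf hQ)

lemma lintegral_rpow_finsetSum_le {s : Finset ι} {u : ι → X → ℝ≥0∞} (w : Measure X)
    (hu : ∀ i ∈ s, Measurable (u i)) (hq : 1 ≤ q) :
    (∫⁻ x, (∑ i ∈ s, u i x) ^ q ∂w) ^ (1 / q) ≤ ∑ i ∈ s, (∫⁻ x, u i x ^ q ∂w) ^ (1 / q) := by
  classical
  induction s using Finset.induction_on with
  | empty => simp [zero_lt_one.trans_le hq]
  | insert i s hi ih =>
    simp only [Finset.sum_insert hi]
    rw [Finset.forall_mem_insert] at hu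
    exact (ENNReal.lintegral_Lp_add_le (μ := w) hu.1.aemeasurable
      (Finset.measurable_sum s hu.2).aemeasurable hq).trans (add_le_add le_rfl (ih hu.2))

end Exponents

section TestingTheorem

variable {F : Finset (Set X)} {τ : Set X → ℝ≥0∞} {σ w : Measure X} {p p' q q' : ℝ}
  {f g : X → ℝ≥0∞} {T T' : ℝ≥0∞}

lemma density_le_two_mul_density_stoppingSet {μ : Measure X} (hF : Laminar F)
    (hσ : Nondegenerate F σ) (hμ : Nondegenerate F μ) {Q : Set X} (hQ : Q ∈ F) :
    density σ μ Q ≤ 2 * density σ μ (stoppingSet F (densityLevel σ μ) Q) := by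
  set P := stoppingSet F (densityLevel σ μ) Q
  have hP : P ∈ F := records_subset _ _ (stoppingSet_mem_records hF _ hQ (hσ.nonempty hQ))
  have hlevel : densityLevel σ μ Q ≤ densityLevel σ μ P :=
    level_le_level_stoppingSet hF hQ (hσ.nonempty hQ)
  calc density σ μ Q ≤ 2 ^ ((densityLevel σ μ Q : ℝ) + 1) := hσ.density_le_two_rpow hμ hQ
    _ = 2 * 2 ^ (densityLevel σ μ Q : ℝ) := by rw [two_rpow_add, ENNReal.rpow_one, mul_comm]
    _ ≤ 2 * 2 ^ (densityLevel σ μ P : ℝ) := by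
        gcongr 2 * ?_
        exact two_rpow_strictMono.monotone (by exact_mod_cast hlevel)
    _ ≤ 2 * density σ μ P := by
        gcongr
        exact hσ.two_rpow_densityLevel_le hμ hP

lemma withDensity_le_setLIntegral_coronaProj_stoppingSet (hF : Laminar F)
    (hm : ∀ Q ∈ F, MeasurableSet Q) (hw : Nondegenerate F w) (hg : Measurable g) (κ : Set X → ℤ)
    {Q : Set X} (hQ : Q ∈ F) :
    w.withDensity g Q ≤ ∫⁻ x in Q, coronaProj (records F κ) w g (stoppingSet F κ Q) x ∂w := by
  have hRF := records_subset F κ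
  refine withDensity_le_setLIntegral_coronaProj (fun S hS => hm S (hRF hS))
    (stoppingSet_mem_records hF κ hQ (hw.nonempty hQ)) (hw.mono hRF) hg (hm Q hQ)
    subset_stoppingSet fun S hS => ?_
  obtain ⟨hSR, hSP⟩ := (mem_children.1 hS).prop
  rcases hF S (hRF hSR) Q hQ with h | h | h
  · exact Or.inl h
  · exact absurd (stoppingSet_subset hSR h) hSP.2
  · exact Or.inr h

open Classical in
lemma sum_fiber_stoppingSet_le (hF : Laminar F) (hm : ∀ Q ∈ F, MeasurableSet Q)
    (hσ : Nondegenerate F σ) (hw : Nondegenerate F w) (hp : 0 < p) (hq : q.HolderConjugate q')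
    (hg : Measurable g) (hσf : Nondegenerate F (σ.withDensity f)) (hT : Testing F τ σ w p q T)
    {P : Set X} (hP : P ∈ records F (densityLevel σ (σ.withDensity f))) :
    ∑ Q ∈ F with stoppingSet F (densityLevel σ (σ.withDensity f)) Q = P,
      τ Q * σ.withDensity f Q * w.withDensity g Q ≤
      2 * T * ((density σ (σ.withDensity f) P ^ p * σ P) ^ (1 / p) *
        (∫⁻ x, coronaProj (records F (densityLevel σ (σ.withDensity f))) w g P x ^ q' ∂w)
          ^ (1 / q')) := by
  set μ := σ.withDensity f
  set κ := densityLevel σ μ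
  set v := coronaProj (records F κ) w g P
  have hRF := records_subset F κ
  have hv : Measurable v := measurable_coronaProj (fun Q hQ => hm Q (hRF hQ)) hP hg
  have hterm : ∀ Q ∈ F.filter (stoppingSet F κ · = P), τ Q * μ Q * w.withDensity g Q ≤
      2 * density σ μ P * (τ Q * σ Q * w.withDensity v Q) := by
    intro Q hQ
    obtain ⟨hQF, rfl⟩ := Finset.mem_filter.1 hQ
    calc τ Q * μ Q * w.withDensity g Q
        = τ Q * (density σ μ Q * σ Q) * w.withDensity g Q := by rw [hσ.density_mul hQF]
      _ ≤ τ Q * (2 * density σ μ (stoppingSet F κ Q) * σ Q) * w.withDensity v Q := by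
          refine mul_le_mul' ?_ ?_
          · gcongr
            exact density_le_two_mul_density_stoppingSet hF hσ hσf hQF
          · rw [withDensity_apply v (hm Q hQF)]
            exact withDensity_le_setLIntegral_coronaProj_stoppingSet hF hm hw hg κ hQF
      _ = _ := by ring
  have hsub : F.filter (stoppingSet F κ · = P) ⊆ below F P := by
    intro Q hQ
    obtain ⟨hQF, rfl⟩ := Finset.mem_filter.1 hQ
    exact mem_below.2 ⟨hQF, subset_stoppingSet⟩
  calc ∑ Q ∈ F with stoppingSet F κ Q = P, τ Q * μ Q * w.withDensity g Q
      ≤ 2 * density σ μ P * ∑ Q ∈ below F P, τ Q * σ Q * w.withDensity v Q := by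
        rw [Finset.mul_sum]
        exact (Finset.sum_le_sum hterm).trans (Finset.sum_le_sum_of_subset hsub)
    _ = 2 * density σ μ P * ∫⁻ x, dyadicOp (below F P) τ σ x * v x ∂w := by
        rw [lintegral_dyadicOp_mul (fun Q hQ => hm Q (below_subset F P hQ)) hv]
    _ ≤ 2 * density σ μ P * (T * σ P ^ (1 / p) * (∫⁻ x, v x ^ q' ∂w) ^ (1 / q')) := by
        gcongr
        exact (ENNReal.lintegral_mul_le_Lp_mul_Lq w hq (measurable_dyadicOp (fun Q hQ =>
          hm Q (below_subset F P hQ)) τ σ).aemeasurable hv.aemeasurable).trans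
          (mul_le_mul_left (hT P (hRF hP)) _)
    _ = 2 * T * ((density σ μ P ^ p * σ P) ^ (1 / p) * (∫⁻ x, v x ^ q' ∂w) ^ (1 / q')) := by
        rw [ENNReal.mul_rpow_of_nonneg _ _ (one_div_nonneg.2 hp.le), ← ENNReal.rpow_mul,
          mul_one_div_cancel hp.ne', ENNReal.rpow_one]
        ring

/-- The constant in the half of the bilinear estimate where the mean of `f` dominates. -/
def halfTestingConst (p q' : ℝ) : ℝ≥0∞ :=
  2 * carlesonConst p ^ (1 / p) * (1 + carlesonConst p) ^ (1 / q')

lemma halfTestingConst_ne_top (hp : 1 < p) (hq' : 0 ≤ q') : halfTestingConst p q' ≠ ⊤ := by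
  have hC := carlesonConst_ne_top hp
  exact ENNReal.mul_ne_top (ENNReal.mul_ne_top ENNReal.ofNat_ne_top
    (ENNReal.rpow_ne_top_of_nonneg (by positivity) hC))
    (ENNReal.rpow_ne_top_of_nonneg (by positivity) (ENNReal.add_ne_top.2 ⟨ENNReal.one_ne_top, hC⟩))

lemma sum_mul_withDensity_le_half (hF : Laminar F) (hm : ∀ Q ∈ F, MeasurableSet Q)
    (hσ : Nondegenerate F σ) (hw : Nondegenerate F w) (hp : p.HolderConjugate p')
    (hq : q.HolderConjugate q') (hpq : p ≤ q) (hf : Measurable f) (hg : Measurable g)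
    (hσf : Nondegenerate F (σ.withDensity f)) (hf1 : ∫⁻ x, f x ^ p ∂σ ≤ 1)
    (hg1 : ∫⁻ x, g x ^ q' ∂w ≤ 1)
    (hfg : ∀ Q ∈ F, density w (w.withDensity g) Q ^ q' * w Q ≤
      density σ (σ.withDensity f) Q ^ p * σ Q)
    (hT : Testing F τ σ w p q T) :
    ∑ Q ∈ F, τ Q * σ.withDensity f Q * w.withDensity g Q ≤ halfTestingConst p q' * T := by
  classical
  set κ := densityLevel σ (σ.withDensity f)
  set R := records F κ
  have hRF : R ⊆ F := records_subset F κ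
  set a : Set X → ℝ≥0∞ := fun P => density σ (σ.withDensity f) P ^ p * σ P
  set b : Set X → ℝ≥0∞ := fun P => ∫⁻ x, coronaProj R w g P x ^ q' ∂w
  have ha : ∑ P ∈ R, a P ≤ carlesonConst p :=
    (sum_records_density_rpow_le hF hm hσ hf hσf hp.lt).trans (mul_le_of_le_one_right' hf1)
  have hb : ∑ P ∈ R, b P ≤ 1 + carlesonConst p :=
    calc ∑ P ∈ R, b P
        ≤ ∫⁻ x, g x ^ q' ∂w + ∑ S ∈ R, density w (w.withDensity g) S ^ q' * w S :=
          sum_lintegral_coronaProj_rpow_le (hF.mono hRF) (fun Q hQ => hm Q (hRF hQ))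
            (fun Q hQ => hσ.nonempty (hRF hQ)) hg hq.symm.pos
      _ ≤ 1 + carlesonConst p :=
          add_le_add hg1 ((Finset.sum_le_sum fun S hS => hfg S (hRF hS)).trans ha)
  calc ∑ Q ∈ F, τ Q * σ.withDensity f Q * w.withDensity g Q
      = ∑ P ∈ R, ∑ Q ∈ F with stoppingSet F κ Q = P,
          τ Q * σ.withDensity f Q * w.withDensity g Q :=
        (Finset.sum_fiberwise_of_maps_to
          (fun Q hQ => stoppingSet_mem_records hF κ hQ (hσ.nonempty hQ)) _).symm
    _ ≤ 2 * T * ∑ P ∈ R, a P ^ (1 / p) * b P ^ (1 / q') := by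
        rw [Finset.mul_sum]
        exact Finset.sum_le_sum fun P hP =>
          sum_fiber_stoppingSet_le hF hm hσ hw hp.pos hq hg hσf hT hP
    _ ≤ 2 * T * ((∑ P ∈ R, a P) ^ (1 / p) * (∑ P ∈ R, b P) ^ (1 / q')) := by
        gcongr
        exact sum_rpow_mul_rpow_le hp hq hpq R a b
    _ ≤ 2 * T * (carlesonConst p ^ (1 / p) * (1 + carlesonConst p) ^ (1 / q')) := by
        gcongr
        · exact hp.one_div_nonneg
        · exact hq.symm.one_div_nonneg
    _ = halfTestingConst p q' * T := by rw [halfTestingConst]; ring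

/-- The constant in the two-weight testing theorem. -/
def testingConst (p q : ℝ) : ℝ≥0∞ :=
  halfTestingConst p q.conjExponent + halfTestingConst q.conjExponent p

lemma testingConst_ne_top (hp : 1 < p) (hq : 1 < q) : testingConst p q ≠ ⊤ := by
  have hq' := (Real.HolderConjugate.conjExponent hq).symm
  exact ENNReal.add_ne_top.2 ⟨halfTestingConst_ne_top hp hq'.nonneg,
    halfTestingConst_ne_top hq'.lt (by linarith)⟩

/- The members of `F` are split according to which of `⟨f⟩_Q^p σ(Q)` and `⟨g⟩_Q^{q'} w(Q)` is the
larger; the two parts are dual to each other. -/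
lemma sum_mul_withDensity_le_of_normalized (hF : Laminar F) (hm : ∀ Q ∈ F, MeasurableSet Q)
    (hσ : Nondegenerate F σ) (hw : Nondegenerate F w) (hp : p.HolderConjugate p')
    (hq : q.HolderConjugate q') (hpq : p ≤ q) (hf : Measurable f) (hg : Measurable g)
    (hf1 : ∫⁻ x, f x ^ p ∂σ ≤ 1) (hg1 : ∫⁻ x, g x ^ q' ∂w ≤ 1)
    (hT : Testing F τ σ w p q T) (hT' : Testing F τ w σ q' p' T') :
    ∑ Q ∈ F, τ Q * σ.withDensity f Q * w.withDensity g Q ≤ testingConst p q * (T + T') := by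
  classical
  set μ := σ.withDensity f
  set ν := w.withDensity g
  have hμt : ∀ Q ∈ F, μ Q ≠ ⊤ := fun Q hQ => withDensity_apply_ne_top hp hf
    (ne_top_of_le_ne_top ENNReal.one_ne_top hf1) (hm Q hQ) (hσ Q hQ).2
  have hνt : ∀ Q ∈ F, ν Q ≠ ⊤ := fun Q hQ => withDensity_apply_ne_top hq.symm hg
    (ne_top_of_le_ne_top ENNReal.one_ne_top hg1) (hm Q hQ) (hw Q hQ).2
  set G := F.filter fun Q => μ Q ≠ 0 ∧ ν Q ≠ 0
  have hGμ : Nondegenerate G μ := fun Q hQ =>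
    ⟨(Finset.mem_filter.1 hQ).2.1, hμt Q (Finset.mem_filter.1 hQ).1⟩
  have hGν : Nondegenerate G ν := fun Q hQ =>
    ⟨(Finset.mem_filter.1 hQ).2.2, hνt Q (Finset.mem_filter.1 hQ).1⟩
  have hsum : ∑ Q ∈ F, τ Q * μ Q * ν Q = ∑ Q ∈ G, τ Q * μ Q * ν Q :=
    (Finset.sum_filter_of_ne fun Q _ h => ⟨right_ne_zero_of_mul (left_ne_zero_of_mul h),
      right_ne_zero_of_mul h⟩).symm
  set c : Set X → Prop := fun Q => density w ν Q ^ q' * w Q ≤ density σ μ Q ^ p * σ Q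
  have hAG : G.filter c ⊆ G := Finset.filter_subset _ _
  have hBG : G.filter (¬ c ·) ⊆ G := Finset.filter_subset _ _
  have hGF : G ⊆ F := Finset.filter_subset _ _
  have hA : ∑ Q ∈ G with c Q, τ Q * μ Q * ν Q ≤ halfTestingConst p q' * T :=
    sum_mul_withDensity_le_half (hF.mono (hAG.trans hGF)) (fun Q hQ => hm Q (hGF (hAG hQ)))
      (hσ.mono (hAG.trans hGF)) (hw.mono (hAG.trans hGF)) hp hq hpq hf hg (hGμ.mono hAG) hf1 hg1
      (fun Q hQ => (Finset.mem_filter.1 hQ).2) (hT.mono (hAG.trans hGF) hq.nonneg)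
  have hB : ∑ Q ∈ G with ¬ c Q, τ Q * ν Q * μ Q ≤ halfTestingConst q' p * T' :=
    sum_mul_withDensity_le_half (hF.mono (hBG.trans hGF)) (fun Q hQ => hm Q (hGF (hBG hQ)))
      (hw.mono (hBG.trans hGF)) (hσ.mono (hBG.trans hGF)) hq.symm hp.symm
      (holderConjugate_le_of_le hp hq hpq) hg hf (hGν.mono hBG) hg1 hf1
      (fun Q hQ => (not_le.1 (Finset.mem_filter.1 hQ).2).le)
      (hT'.mono (hBG.trans hGF) hp.symm.nonneg)
  rw [hsum, ← Finset.sum_filter_add_sum_filter_not G c]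
  simp_rw [mul_right_comm (τ _) (ν _)] at hB
  refine (add_le_add hA hB).trans ?_
  rw [testingConst, hq.conjExponent_eq, add_mul]
  gcongr
  · exact le_self_add
  · exact le_add_self

lemma lintegral_normalize_rpow_le_one (hf : Measurable f) (hp : 0 < p) :
    ∫⁻ x, (((∫⁻ y, f y ^ p ∂σ) ^ (1 / p))⁻¹ • f) x ^ p ∂σ ≤ 1 := by
  simp only [Pi.smul_apply, smul_eq_mul, ENNReal.mul_rpow_of_nonneg _ _ hp.le]
  rw [lintegral_const_mul _ (hf.pow_const p), ENNReal.inv_rpow, ← ENNReal.rpow_mul,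
    one_div_mul_cancel hp.ne', ENNReal.rpow_one]
  exact ENNReal.inv_mul_le_one _

lemma withDensity_eq_mul_withDensity_normalize (hp : p.HolderConjugate p') (hf : Measurable f)
    (hft : ∫⁻ x, f x ^ p ∂σ ≠ ⊤) {Q : Set X} (hQ : MeasurableSet Q) :
    σ.withDensity f Q = (∫⁻ y, f y ^ p ∂σ) ^ (1 / p) *
      σ.withDensity (((∫⁻ y, f y ^ p ∂σ) ^ (1 / p))⁻¹ • f) Q := by
  have hle := withDensity_le_lintegral_rpow_mul (σ := σ) hp hf hQ
  set I := (∫⁻ y, f y ^ p ∂σ) ^ (1 / p)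
  have hI : I ≠ ⊤ := ENNReal.rpow_ne_top_of_nonneg hp.one_div_nonneg hft
  rcases eq_or_ne I 0 with hI0 | hI0
  · rw [hI0, zero_mul] at hle
    rw [hI0, zero_mul, le_zero_iff.1 hle]
  · rw [withDensity_smul _ hf, Measure.smul_apply, smul_eq_mul, ← mul_assoc,
      ENNReal.mul_inv_cancel hI0 hI, one_mul]

lemma sum_mul_withDensity_le (hF : Laminar F) (hm : ∀ Q ∈ F, MeasurableSet Q)
    (hσ : Nondegenerate F σ) (hw : Nondegenerate F w) (hp : p.HolderConjugate p')
    (hq : q.HolderConjugate q') (hpq : p ≤ q) (hf : Measurable f) (hg : Measurable g)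
    (hft : ∫⁻ x, f x ^ p ∂σ ≠ ⊤) (hgt : ∫⁻ x, g x ^ q' ∂w ≠ ⊤)
    (hT : Testing F τ σ w p q T) (hT' : Testing F τ w σ q' p' T') :
    ∑ Q ∈ F, τ Q * σ.withDensity f Q * w.withDensity g Q ≤
      testingConst p q * (T + T') * (∫⁻ x, f x ^ p ∂σ) ^ (1 / p) *
        (∫⁻ x, g x ^ q' ∂w) ^ (1 / q') := by
  set I := (∫⁻ x, f x ^ p ∂σ) ^ (1 / p)
  set J := (∫⁻ x, g x ^ q' ∂w) ^ (1 / q')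
  calc ∑ Q ∈ F, τ Q * σ.withDensity f Q * w.withDensity g Q
      = (∑ Q ∈ F, τ Q * σ.withDensity (I⁻¹ • f) Q * w.withDensity (J⁻¹ • g) Q) * (I * J) := by
        rw [Finset.sum_mul]
        refine Finset.sum_congr rfl fun Q hQ => ?_
        rw [withDensity_eq_mul_withDensity_normalize hp hf hft (hm Q hQ),
          withDensity_eq_mul_withDensity_normalize hq.symm hg hgt (hm Q hQ)]
        ring
    _ ≤ testingConst p q * (T + T') * (I * J) := by
        gcongr
        exact sum_mul_withDensity_le_of_normalized hF hm hσ hw hp hq hpq (hf.const_smul _)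
          (hg.const_smul _) (lintegral_normalize_rpow_le_one hf hp.pos)
          (lintegral_normalize_rpow_le_one hg hq.symm.pos) hT hT'
    _ = _ := (mul_assoc _ _ _).symm

lemma lintegral_dyadicOp_rpow_ne_top {μ : Measure X} (hm : ∀ Q ∈ F, MeasurableSet Q)
    (hτμ : ∀ Q ∈ F, τ Q * μ Q ≠ ⊤) (hw : ∀ Q ∈ F, w Q ≠ ⊤) (hq : 1 ≤ q) :
    ∫⁻ x, dyadicOp F τ μ x ^ q ∂w ≠ ⊤ := by
  have hq0 : 0 < q := zero_lt_one.trans_le hq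
  suffices (∫⁻ x, dyadicOp F τ μ x ^ q ∂w) ^ (1 / q) ≠ ⊤ by
    simpa [ENNReal.rpow_eq_top_iff, hq0, hq0.not_gt] using this
  refine ne_top_of_le_ne_top (ENNReal.sum_ne_top.2 fun Q hQ => ?_) (lintegral_rpow_finsetSum_le w
    (fun Q hQ => measurable_const.indicator (hm Q hQ)) hq)
  have hpow : (fun x => Q.indicator (fun _ => τ Q * μ Q) x ^ q) =
      Q.indicator fun _ => (τ Q * μ Q) ^ q := by
    ext x
    by_cases hx : x ∈ Q <;> simp [hx, hq0]
  rw [hpow, lintegral_indicator (hm Q hQ), setLIntegral_const]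
  exact ENNReal.rpow_ne_top_of_nonneg (by positivity)
    (ENNReal.mul_ne_top (ENNReal.rpow_ne_top_of_nonneg hq0.le (hτμ Q hQ)) (hw Q hQ))

/- Duality: the bilinear estimate is applied to `g = U ^ (q - 1)`, where `U` is the image of `f`. -/
theorem lintegral_dyadicOp_rpow_le (hF : Laminar F) (hm : ∀ Q ∈ F, MeasurableSet Q)
    (hσ : Nondegenerate F σ) (hw : Nondegenerate F w) (hτ : ∀ Q ∈ F, τ Q ≠ ⊤)
    (hp : p.HolderConjugate p') (hq : q.HolderConjugate q') (hpq : p ≤ q) (hf : Measurable f)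
    (hft : ∫⁻ x, f x ^ p ∂σ ≠ ⊤)
    (hT : Testing F τ σ w p q T) (hT' : Testing F τ w σ q' p' T') :
    (∫⁻ x, dyadicOp F τ (σ.withDensity f) x ^ q ∂w) ^ (1 / q) ≤
      testingConst p q * (T + T') * (∫⁻ x, f x ^ p ∂σ) ^ (1 / p) := by
  set U := dyadicOp F τ (σ.withDensity f)
  set V := ∫⁻ x, U x ^ q ∂w
  have hU : Measurable U := measurable_dyadicOp hm τ _
  have hVt : V ≠ ⊤ := lintegral_dyadicOp_rpow_ne_top hm (fun Q hQ => ENNReal.mul_ne_top (hτ Q hQ)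
    (withDensity_apply_ne_top hp hf hft (hm Q hQ) (hσ Q hQ).2)) (fun Q hQ => (hw Q hQ).2) hq.lt.le
  have hdual : ∀ x, (U x ^ (q - 1)) ^ q' = U x ^ q := fun x => by
    rw [← ENNReal.rpow_mul, hq.sub_one_mul_conj]
  have hV : ∑ Q ∈ F, τ Q * σ.withDensity f Q * w.withDensity (fun x => U x ^ (q - 1)) Q = V := by
    rw [← lintegral_dyadicOp_mul hm (hU.pow_const (q - 1))]
    exact lintegral_congr fun x => by rw [mul_comm, ← rpow_eq_rpow_sub_one_mul _ hq.lt.le]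
  have hbil := sum_mul_withDensity_le hF hm hσ hw hp hq hpq hf (hU.pow_const (q - 1)) hft
    (by simpa only [hdual] using hVt) hT hT'
  simp only [hdual, hV] at hbil
  rcases eq_or_ne V 0 with hV0 | hV0
  · rw [hV0, ENNReal.zero_rpow_of_pos hq.one_div_pos]
    exact zero_le
  have hVq0 : V ^ (1 / q') ≠ 0 := by simp [ENNReal.rpow_eq_zero_iff, hV0, hVt]
  have hVqt : V ^ (1 / q') ≠ ⊤ := ENNReal.rpow_ne_top_of_nonneg hq.symm.one_div_nonneg hVt
  exact (ENNReal.mul_le_mul_iff_left hVq0 hVqt).1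
    ((rpow_eq_rpow_inv_mul_rpow_inv hq V).symm.trans_le hbil)

end TestingTheorem

/-! ### Sparse sums over records -/

section Chains

variable {s : Finset ι} {κ : ι → ℤ}

omit [MeasurableSpace X] in
lemma sum_two_rpow_neg_abs_le (hκ : InjOn κ s) (a : ℝ) (k : ℤ) :
    ∑ i ∈ s, (2 : ℝ≥0∞) ^ (-|(κ i : ℝ) - k| * a) ≤ 2 * geomConst a := by
  classical
  rw [← Finset.sum_filter_add_sum_filter_not s (k ≤ κ ·), two_mul]
  refine add_le_add ?_ ?_
  · have h := sum_two_rpow_neg_le (s := s.filter (k ≤ κ ·)) (κ := fun i => κ i - k) (k₀ := 0)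
      (fun i hi j hj hij => hκ (Finset.mem_of_mem_filter i hi) (Finset.mem_of_mem_filter j hj)
        (sub_left_injective hij)) a (fun i hi => sub_nonneg.2 (Finset.mem_filter.1 hi).2)
    rw [Int.cast_zero, neg_zero, zero_mul, ENNReal.rpow_zero, one_mul] at h
    refine le_of_eq_of_le (Finset.sum_congr rfl fun i hi => ?_) h
    have hi' : (k : ℝ) ≤ κ i := by exact_mod_cast (Finset.mem_filter.1 hi).2
    rw [abs_of_nonneg (sub_nonneg.2 hi'), Int.cast_sub]
  · have h := sum_two_rpow_neg_le (s := s.filter (¬ k ≤ κ ·)) (κ := fun i => k - κ i) (k₀ := 0)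
      (fun i hi j hj hij => hκ (Finset.mem_of_mem_filter i hi) (Finset.mem_of_mem_filter j hj)
        (sub_right_injective hij)) a
      (fun i hi => sub_nonneg.2 (not_le.1 (Finset.mem_filter.1 hi).2).le)
    rw [Int.cast_zero, neg_zero, zero_mul, ENNReal.rpow_zero, one_mul] at h
    refine le_of_eq_of_le (Finset.sum_congr rfl fun i hi => ?_) h
    have hi' : (κ i : ℝ) ≤ k := by exact_mod_cast (not_le.1 (Finset.mem_filter.1 hi).2).le
    rw [abs_of_nonpos (sub_nonpos.2 hi'), Int.cast_sub, neg_sub]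

/-- The constant in the estimate of a sum along a chain by its off-diagonal energy. -/
def chainConst (q : ℝ) : ℝ≥0∞ := 2 * geomConst (1 / (2 * q))

lemma chainConst_ne_top {q : ℝ} (hq : 0 < q) : chainConst q ≠ ⊤ :=
  ENNReal.mul_ne_top ENNReal.ofNat_ne_top (geomConst_ne_top (by positivity))

/- Only the terms of the energy that pair `i` with the index `m` of the largest `l` are needed: they
show that `l i ^ q ≤ 2 ^ (-|κ i - κ m| / 2) * energy`, and these bounds form a geometric series. -/
lemma sum_le_chainConst_mul_energy (hκ : InjOn κ s) {c e q : ℝ} (hc : 0 ≤ c) (he : 0 ≤ e)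
    (hq : 0 < q) (hce : c + e = q) (l : ι → ℝ≥0∞) :
    ∑ i ∈ s, l i ≤ chainConst q * (∑ j ∈ s, ∑ i ∈ s with κ j ≤ κ i,
      (2 : ℝ≥0∞) ^ (((κ i : ℝ) - κ j) / 2) * (l i ^ c * l j ^ e)) ^ (1 / q) := by
  rcases s.eq_empty_or_nonempty with rfl | hs
  · simp
  obtain ⟨m, hm, hmax⟩ := s.exists_max_image l hs
  set E := ∑ j ∈ s, ∑ i ∈ s with κ j ≤ κ i,
    (2 : ℝ≥0∞) ^ (((κ i : ℝ) - κ j) / 2) * (l i ^ c * l j ^ e)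
  have hterm : ∀ j ∈ s, ∀ i ∈ s, κ j ≤ κ i →
      (2 : ℝ≥0∞) ^ (((κ i : ℝ) - κ j) / 2) * (l i ^ c * l j ^ e) ≤ E := fun j hj i hi hij =>
    (Finset.single_le_sum (f := fun i => (2 : ℝ≥0∞) ^ (((κ i : ℝ) - κ j) / 2) *
      (l i ^ c * l j ^ e)) (fun _ _ => zero_le) (Finset.mem_filter.2 ⟨hi, hij⟩)).trans
      (Finset.single_le_sum (f := fun j => ∑ i ∈ s with κ j ≤ κ i,
        (2 : ℝ≥0∞) ^ (((κ i : ℝ) - κ j) / 2) * (l i ^ c * l j ^ e)) (fun _ _ => zero_le) hj)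
  have henergy : ∀ i ∈ s, (2 : ℝ≥0∞) ^ (|(κ i : ℝ) - κ m| / 2) * l i ^ q ≤ E := by
    intro i hi
    have hli : l i ≤ l m := hmax i hi
    rcases le_total (κ m) (κ i) with h | h
    · have hR : (κ m : ℝ) ≤ κ i := by exact_mod_cast h
      rw [abs_of_nonneg (sub_nonneg.2 hR), ← hce, ENNReal.rpow_add_of_nonneg _ _ hc he]
      exact le_trans (by gcongr) (hterm m hm i hi h)
    · have hR : (κ i : ℝ) ≤ κ m := by exact_mod_cast h
      rw [abs_of_nonpos (sub_nonpos.2 hR), neg_sub, ← hce, ENNReal.rpow_add_of_nonneg _ _ hc he]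
      exact le_trans (by gcongr) (hterm i hi m hm h)
  have hdecay : ∀ i ∈ s, l i ≤
      (2 : ℝ≥0∞) ^ (-|(κ i : ℝ) - κ m| * (1 / (2 * q))) * E ^ (1 / q) := by
    intro i hi
    calc l i = (2 : ℝ≥0∞) ^ (-|(κ i : ℝ) - κ m| * (1 / (2 * q))) *
          ((2 : ℝ≥0∞) ^ (|(κ i : ℝ) - κ m| / 2) * l i ^ q) ^ (1 / q) := by
          rw [ENNReal.mul_rpow_of_nonneg _ _ (by positivity), ← ENNReal.rpow_mul,
            ← ENNReal.rpow_mul, mul_one_div_cancel hq.ne', ENNReal.rpow_one, ← mul_assoc,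
            ← two_rpow_add, show -|(κ i : ℝ) - κ m| * (1 / (2 * q)) +
              |(κ i : ℝ) - κ m| / 2 * (1 / q) = 0 by field_simp; ring,
            ENNReal.rpow_zero, one_mul]
      _ ≤ _ := by gcongr; exact henergy i hi
  calc ∑ i ∈ s, l i
      ≤ ∑ i ∈ s, (2 : ℝ≥0∞) ^ (-|(κ i : ℝ) - κ m| * (1 / (2 * q))) * E ^ (1 / q) :=
        Finset.sum_le_sum hdecay
    _ ≤ chainConst q * E ^ (1 / q) := by
        rw [← Finset.sum_mul]
        gcongr
        exact sum_two_rpow_neg_abs_le hκ _ _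

end Chains

section Packing

variable {F G : Finset (Set X)} {μ σ : Measure X} {P : Set X}

lemma sum_records_two_rpow_mul_le (hF : Laminar F) (hm : ∀ Q ∈ F, MeasurableSet Q)
    (hμ : Nondegenerate F μ) (hσ : Nondegenerate F σ) (hG : G ⊆ records F (densityLevel μ σ))
    (hGP : ∀ Q ∈ G, Q ⊆ P) (a : ℝ) {k₀ : ℤ} (hk : ∀ Q ∈ G, k₀ ≤ densityLevel μ σ Q) :
    ∑ Q ∈ G, (2 : ℝ≥0∞) ^ ((densityLevel μ σ Q : ℝ) * (1 - a)) * μ Q ≤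
      2 ^ (-(k₀ : ℝ) * a) * geomConst a * σ P := by
  classical
  set κ := densityLevel μ σ
  have hGF : G ⊆ F := hG.trans (records_subset F κ)
  calc ∑ Q ∈ G, (2 : ℝ≥0∞) ^ ((κ Q : ℝ) * (1 - a)) * μ Q
      ≤ ∑ Q ∈ G, ∫⁻ x in P, Q.indicator (fun _ => (2 : ℝ≥0∞) ^ (-(κ Q : ℝ) * a)) x ∂σ := by
        refine Finset.sum_le_sum fun Q hQ => ?_
        rw [lintegral_indicator (hm Q (hGF hQ)), setLIntegral_const,
          Measure.restrict_apply (hm Q (hGF hQ)), inter_eq_left.2 (hGP Q hQ),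
          show (κ Q : ℝ) * (1 - a) = -(κ Q : ℝ) * a + κ Q by ring, two_rpow_add, mul_assoc]
        gcongr
        exact hμ.two_rpow_densityLevel_mul_le hσ (hGF hQ)
    _ = ∫⁻ x in P, ∑ Q ∈ G, Q.indicator (fun _ => (2 : ℝ≥0∞) ^ (-(κ Q : ℝ) * a)) x ∂σ :=
        (lintegral_finsetSum _ fun Q hQ => measurable_const.indicator (hm Q (hGF hQ))).symm
    _ ≤ ∫⁻ x in P, 2 ^ (-(k₀ : ℝ) * a) * geomConst a ∂σ := by
        gcongr with x
        simp only [indicator_apply]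
        rw [← Finset.sum_filter]
        refine sum_two_rpow_neg_le ((records_level_injOn hF κ x).mono fun Q hQ => ?_) a
          fun Q hQ => hk Q (Finset.mem_of_mem_filter Q hQ)
        exact ⟨hG (Finset.mem_of_mem_filter Q hQ), (Finset.mem_filter.1 hQ).2⟩
    _ = _ := setLIntegral_const _ _

lemma sum_below_records_half_le (hF : Laminar F) (hm : ∀ Q ∈ F, MeasurableSet Q)
    (hμ : Nondegenerate F μ) (hσ : Nondegenerate F σ) (hP : P ∈ records F (densityLevel μ σ)) :
    ∑ Q ∈ below (records F (densityLevel μ σ)) P,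
      (2 : ℝ≥0∞) ^ (((densityLevel μ σ Q : ℝ) - densityLevel μ σ P) / 2) * μ Q ≤
      2 * geomConst (1 / 2) * μ P := by
  set κ := densityLevel μ σ
  have hpack := sum_records_two_rpow_mul_le hF hm hμ hσ (below_subset _ P)
    (fun Q hQ => (mem_below.1 hQ).2) (1 / 2) (k₀ := κ P)
    fun Q hQ => records_level_anti (mem_below.1 hQ).1 hP (mem_below.1 hQ).2
  calc ∑ Q ∈ below (records F κ) P, (2 : ℝ≥0∞) ^ (((κ Q : ℝ) - κ P) / 2) * μ Q
      = 2 ^ (-(κ P : ℝ) / 2) *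
          ∑ Q ∈ below (records F κ) P, 2 ^ ((κ Q : ℝ) * (1 - 1 / 2)) * μ Q := by
        rw [Finset.mul_sum]
        refine Finset.sum_congr rfl fun Q _ => ?_
        rw [← mul_assoc, ← two_rpow_add]
        ring_nf
    _ ≤ 2 ^ (-(κ P : ℝ) / 2) * (2 ^ (-(κ P : ℝ) * (1 / 2)) * geomConst (1 / 2) *
          (2 ^ ((κ P : ℝ) + 1) * μ P)) := by
        gcongr
        exact hpack.trans (by gcongr; exact hμ.le_two_rpow_mul hσ (records_subset F κ hP))
    _ = (2 ^ (-(κ P : ℝ) / 2) * 2 ^ (-(κ P : ℝ) * (1 / 2)) * 2 ^ ((κ P : ℝ) + 1)) *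
          geomConst (1 / 2) * μ P := by ring
    _ = _ := by
        rw [← two_rpow_add, ← two_rpow_add,
          show -(κ P : ℝ) / 2 + -(κ P : ℝ) * (1 / 2) + ((κ P : ℝ) + 1) = 1 by ring,
          ENNReal.rpow_one]

end Packing

section ThickPart

variable {F : Finset (Set X)} {μ σ : Measure X} {P : Set X}

open Classical in
/-- The points of `P` outside the records in `P` whose level exceeds that of `P` by three or more.
For density levels this is at least half of `P`, so that the records form a sparse family. -/
def thickPart (F : Finset (Set X)) (κ : Set X → ℤ) (P : Set X) : Set X :=
  P \ ⋃ S ∈ (below (records F κ) P).filter (κ P + 3 ≤ κ ·), S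

omit [MeasurableSpace X] in
open Classical in
lemma Laminar.card_mem_thickPart_le (hF : Laminar F) (κ : Set X → ℤ) (x : X) :
    ((records F κ).filter (x ∈ thickPart F κ ·)).card ≤ 3 := by
  set s := (records F κ).filter (x ∈ thickPart F κ ·)
  rcases s.eq_empty_or_nonempty with h | h
  · simp [h]
  obtain ⟨Q, hQ, hmin⟩ := s.exists_min_image κ h
  obtain ⟨hQS, hxQ⟩ := Finset.mem_filter.1 hQ
  have hmax : ∀ P ∈ s, κ P < κ Q + 3 := by
    intro P hP
    obtain ⟨hPS, hxP⟩ := Finset.mem_filter.1 hP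
    by_contra! hlt
    rcases hF.subset_or_ssubset (records_subset F κ hPS) (records_subset F κ hQS) hxP.1 hxQ.1
      with h | h
    · exact hxQ.2 (mem_biUnion (Finset.mem_filter.2 ⟨mem_below.2 ⟨hPS, h⟩, hlt⟩) hxP.1)
    · have := records_level_anti hQS hPS h.1
      omega
  have hinj : InjOn κ s := by
    refine (records_level_injOn hF κ x).mono fun P hP => ?_
    exact ⟨Finset.mem_of_mem_filter P hP, (Finset.mem_filter.1 hP).2.1⟩
  have hcard := Finset.card_le_card_of_injOn (t := Finset.Ico (κ Q) (κ Q + 3)) κ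
    (fun P hP => Finset.mem_Ico.2 ⟨hmin P hP, hmax P hP⟩) hinj
  simpa using hcard

lemma measurableSet_thickPart (hm : ∀ Q ∈ F, MeasurableSet Q) (κ : Set X → ℤ) (hP : P ∈ F) :
    MeasurableSet (thickPart F κ P) := by
  classical
  exact (hm P hP).diff (Finset.measurableSet_biUnion _ fun S hS =>
    hm S (records_subset F κ (below_subset _ P (Finset.mem_of_mem_filter S hS))))

lemma measure_le_two_mul_measure_thickPart (hF : Laminar F) (hm : ∀ Q ∈ F, MeasurableSet Q)
    (hμ : Nondegenerate F μ) (hσ : Nondegenerate F σ) (hP : P ∈ records F (densityLevel μ σ)) :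
    μ P ≤ 2 * μ (thickPart F (densityLevel μ σ) P) := by
  classical
  set κ := densityLevel μ σ
  have hPF := records_subset F κ hP
  set G := (below (records F κ) P).filter (κ P + 3 ≤ κ ·)
  have hpack := sum_records_two_rpow_mul_le hF hm hμ hσ (G := G) (P := P)
    (fun Q hQ => below_subset _ P (Finset.mem_of_mem_filter Q hQ))
    (fun Q hQ => (mem_below.1 (Finset.mem_of_mem_filter Q hQ)).2) 1 (k₀ := κ P + 3)
    fun Q hQ => (Finset.mem_filter.1 hQ).2
  have hgeom : geomConst 1 = 2 ^ (1 : ℝ) := by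
    rw [geomConst, ENNReal.rpow_neg_one, ENNReal.one_sub_inv_two, inv_inv, ENNReal.rpow_one]
  have hthin : 2 * μ (⋃ S ∈ G, S) ≤ μ P := by
    calc 2 * μ (⋃ S ∈ G, S) ≤ 2 * ∑ S ∈ G, μ S := by gcongr; exact measure_biUnion_finset_le G _
      _ = 2 ^ (1 : ℝ) * ∑ Q ∈ G, 2 ^ ((κ Q : ℝ) * (1 - 1)) * μ Q := by simp
      _ ≤ 2 ^ (1 : ℝ) * (2 ^ (-((κ P + 3 : ℤ) : ℝ) * 1) * 2 ^ (1 : ℝ) *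
            (2 ^ ((κ P : ℝ) + 1) * μ P)) := by
          rw [← hgeom]
          gcongr
          exact hpack.trans (by gcongr; exact hμ.le_two_rpow_mul hσ hPF)
      _ = μ P := by
          rw [← mul_assoc, ← mul_assoc, ← two_rpow_add, ← two_rpow_add, ← two_rpow_add,
            Int.cast_add, Int.cast_ofNat,
            show 1 + (-((κ P : ℝ) + 3) * 1 + 1) + ((κ P : ℝ) + 1) = 0 by ring,
            ENNReal.rpow_zero, one_mul]
  have hcover : μ P ≤ μ (thickPart F κ P) + μ (⋃ S ∈ G, S) :=
    (measure_mono (sdiff_union_self.symm ▸ subset_union_left)).trans (measure_union_le _ _)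
  refine (ENNReal.add_le_add_iff_right (hμ P hPF).2).1 ?_
  calc μ P + μ P ≤ 2 * (μ (thickPart F κ P) + μ (⋃ S ∈ G, S)) := by
        rw [← two_mul]
        gcongr
    _ ≤ 2 * μ (thickPart F κ P) + μ P := by
        rw [mul_add]
        gcongr

end ThickPart

section MaximalMembers

variable {F : Finset (Set X)}

open Classical in
/-- The maximal members of `F`. -/
def maximals (F : Finset (Set X)) : Finset (Set X) := F.filter (Maximal (· ∈ F))

omit [MeasurableSpace X] in
lemma Laminar.pairwiseDisjoint_maximals (hF : Laminar F) :
    (maximals F : Set (Set X)).PairwiseDisjoint id := by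
  classical
  intro S hS T hT hne
  replace hS : Maximal (· ∈ F) S := (Finset.mem_filter.1 hS).2
  replace hT : Maximal (· ∈ F) T := (Finset.mem_filter.1 hT).2
  refine Set.disjoint_left.2 fun x hxS hxT => hne ?_
  rcases hF.subset_or_ssubset hS.prop hT.prop hxS hxT with h | h
  · exact hS.eq_of_subset hT.prop h
  · exact (hT.eq_of_subset hS.prop h.1).symm

omit [MeasurableSpace X] in
lemma sum_le_sum_maximals_below {G : Finset (Set X)} (hGF : G ⊆ F) (a : Set X → ℝ≥0∞) :
    ∑ P ∈ G, a P ≤ ∑ T ∈ maximals F, ∑ P ∈ below G T, a P := by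
  classical
  calc ∑ P ∈ G, a P ≤ ∑ P ∈ G, ∑ T ∈ maximals F with P ⊆ T, a P := by
        refine Finset.sum_le_sum fun P hP => ?_
        obtain ⟨T, hPT, hT⟩ := F.exists_le_maximal (hGF hP)
        exact Finset.single_le_sum (f := fun _ => a P) (fun _ _ => zero_le)
          (Finset.mem_filter.2 ⟨Finset.mem_filter.2 ⟨hT.prop, hT⟩, hPT⟩)
    _ = ∑ T ∈ maximals F, ∑ P ∈ below G T, a P := by
        refine Finset.sum_comm' fun P T => ?_
        rw [Finset.mem_filter, mem_below]
        tauto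

lemma Laminar.sum_maximals_rpow_le (hF : Laminar F) (hm : ∀ Q ∈ F, MeasurableSet Q)
    (σ : Measure X) {e : ℝ} (he : 1 ≤ e) {R : Set X} (hR : ∀ Q ∈ F, Q ⊆ R) :
    ∑ T ∈ maximals F, σ T ^ e ≤ σ R ^ e := by
  classical
  have hsub : maximals F ⊆ F := Finset.filter_subset _ _
  refine (sum_rpow_le_rpow_sum _ _ he).trans (ENNReal.rpow_le_rpow ?_ (by positivity))
  exact (measure_biUnion_finset (f := id) hF.pairwiseDisjoint_maximals fun T hT =>
    hm T (hsub hT)).symm.trans_le (measure_mono (iUnion₂_subset fun T hT => hR T (hsub hT)))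

end MaximalMembers

section SparseSums

variable {F : Finset (Set X)} {μ σ w : Measure X} {l τ : Set X → ℝ≥0∞} {c e q : ℝ}

lemma sum_below_records_rpow_le (hF : Laminar F) (hm : ∀ Q ∈ F, MeasurableSet Q)
    (hμ : Nondegenerate F μ) (hσ : Nondegenerate F σ) (he : 0 ≤ e) {T : Set X} {M : X → ℝ≥0∞}
    (hl : ∀ P ∈ F, P ⊆ T → ∀ x ∈ P, l P ≤ M x) :
    ∑ P ∈ below (records F (densityLevel μ σ)) T, l P ^ e * μ P ≤
      6 * ∫⁻ x in T, M x ^ e ∂μ := by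
  classical
  set κ := densityLevel μ σ
  set S := below (records F κ) T
  have hSR : S ⊆ records F κ := below_subset _ T
  have hSF : S ⊆ F := hSR.trans (records_subset F κ)
  have hmt : ∀ P ∈ S, MeasurableSet (thickPart F κ P) := fun P hP =>
    measurableSet_thickPart hm κ (hSF hP)
  have hoverlap : ∀ x, ∑ P ∈ S, (thickPart F κ P).indicator (fun _ => l P ^ e) x ≤
      3 * M x ^ e := by
    intro x
    simp only [indicator_apply]
    rw [← Finset.sum_filter]
    calc ∑ P ∈ S with x ∈ thickPart F κ P, l P ^ e
        ≤ (S.filter (x ∈ thickPart F κ ·)).card • M x ^ e := by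
          refine Finset.sum_le_card_nsmul _ _ _ fun P hP => ?_
          obtain ⟨hPS, hx⟩ := Finset.mem_filter.1 hP
          exact ENNReal.rpow_le_rpow (hl P (hSF hPS) (mem_below.1 hPS).2 x hx.1) he
      _ ≤ 3 * M x ^ e := by
          rw [nsmul_eq_mul]
          gcongr
          exact_mod_cast (Finset.card_le_card (Finset.filter_subset_filter _ hSR)).trans
            (hF.card_mem_thickPart_le κ x)
  calc ∑ P ∈ S, l P ^ e * μ P ≤ ∑ P ∈ S, l P ^ e * (2 * μ (thickPart F κ P)) := by
        gcongr with P hP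
        exact measure_le_two_mul_measure_thickPart hF hm hμ hσ (hSR hP)
    _ = 2 * ∑ P ∈ S, ∫⁻ x in T, (thickPart F κ P).indicator (fun _ => l P ^ e) x ∂μ := by
        rw [Finset.mul_sum]
        refine Finset.sum_congr rfl fun P hP => ?_
        have hPT : thickPart F κ P ⊆ T := sdiff_subset.trans (mem_below.1 hP).2
        rw [lintegral_indicator (hmt P hP), setLIntegral_const,
          Measure.restrict_apply (hmt P hP), inter_eq_left.2 hPT]
        ring
    _ = 2 * ∫⁻ x in T, ∑ P ∈ S, (thickPart F κ P).indicator (fun _ => l P ^ e) x ∂μ := by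
        rw [lintegral_finsetSum _ fun P hP => measurable_const.indicator (hmt P hP)]
    _ ≤ 2 * ∫⁻ x in T, 3 * M x ^ e ∂μ := by gcongr with x; exact hoverlap x
    _ = 6 * ∫⁻ x in T, M x ^ e ∂μ := by
        rw [lintegral_const_mul' _ _ ENNReal.ofNat_ne_top, ← mul_assoc]
        norm_num

lemma sum_records_rpow_le (hF : Laminar F) (hm : ∀ Q ∈ F, MeasurableSet Q)
    (hμ : Nondegenerate F μ) (hσ : Nondegenerate F σ) (he : 1 ≤ e) {M : Set X → X → ℝ≥0∞}
    (hl : ∀ T ∈ F, ∀ P ∈ F, P ⊆ T → ∀ x ∈ P, l P ≤ M T x) {B : ℝ≥0∞}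
    (hM : ∀ T ∈ F, ∫⁻ x in T, M T x ^ e ∂μ ≤ B * σ T ^ e) {R : Set X} (hR : ∀ Q ∈ F, Q ⊆ R) :
    ∑ P ∈ records F (densityLevel μ σ), l P ^ e * μ P ≤ 6 * B * σ R ^ e := by
  classical
  have hmax : maximals F ⊆ F := Finset.filter_subset _ _
  calc ∑ P ∈ records F (densityLevel μ σ), l P ^ e * μ P
      ≤ ∑ T ∈ maximals F, ∑ P ∈ below (records F (densityLevel μ σ)) T, l P ^ e * μ P :=
        sum_le_sum_maximals_below (records_subset F _) _
    _ ≤ ∑ T ∈ maximals F, 6 * B * σ T ^ e := by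
        refine Finset.sum_le_sum fun T hT => ?_
        rw [mul_assoc]
        exact (sum_below_records_rpow_le hF hm hμ hσ (by positivity) (hl T (hmax hT))).trans
          (mul_le_mul_right (hM T (hmax hT)) 6)
    _ ≤ 6 * B * σ R ^ e := by
        rw [← Finset.mul_sum]
        gcongr
        exact hF.sum_maximals_rpow_le hm σ he hR

lemma dyadicOp_le_dyadicOp_records (hF : Laminar F) (hμ : Nondegenerate F μ)
    (hσ : Nondegenerate F σ) {D : ℝ≥0∞}
    (hD : ∀ P ∈ F, ∀ x, dyadicOp (below F P) τ μ x ≤ D * (τ P * μ P)) (x : X) :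
    dyadicOp F τ σ x ≤ 2 * D * dyadicOp (records F (densityLevel μ σ)) τ σ x := by
  classical
  set κ := densityLevel μ σ
  have hSF : records F κ ⊆ F := records_subset F κ
  have hfiber : ∀ P, F.filter (stoppingSet F κ · = P) ⊆ below F P := by
    intro P Q hQ
    obtain ⟨hQF, rfl⟩ := Finset.mem_filter.1 hQ
    exact mem_below.2 ⟨hQF, subset_stoppingSet⟩
  have hdensity : ∀ Q ∈ F, τ Q * σ Q ≤
      2 ^ ((κ (stoppingSet F κ Q) : ℝ) + 1) * (τ Q * μ Q) := by
    intro Q hQ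
    rw [mul_left_comm]
    gcongr
    refine (hμ.le_two_rpow_mul hσ hQ).trans ?_
    gcongr
    · exact one_le_two
    · exact level_le_level_stoppingSet hF hQ (hσ.nonempty hQ)
  rw [dyadicOp, ← Finset.sum_fiberwise_of_maps_to (t := records F κ) (g := stoppingSet F κ)
    fun Q hQ => stoppingSet_mem_records hF κ hQ (hσ.nonempty hQ), dyadicOp, Finset.mul_sum]
  refine Finset.sum_le_sum fun P hP => ?_
  by_cases hx : x ∈ P
  · calc ∑ Q ∈ F with stoppingSet F κ Q = P, Q.indicator (fun _ => τ Q * σ Q) x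
        ≤ ∑ Q ∈ F with stoppingSet F κ Q = P,
            2 ^ ((κ P : ℝ) + 1) * Q.indicator (fun _ => τ Q * μ Q) x := by
          refine Finset.sum_le_sum fun Q hQ => ?_
          obtain ⟨hQF, rfl⟩ := Finset.mem_filter.1 hQ
          by_cases hxQ : x ∈ Q
          · simpa only [indicator_of_mem hxQ] using hdensity Q hQF
          · simp only [indicator_of_notMem hxQ, zero_le]
      _ ≤ 2 ^ ((κ P : ℝ) + 1) * dyadicOp (below F P) τ μ x := by
          rw [← Finset.mul_sum]
          gcongr
          exact Finset.sum_le_sum_of_subset (hfiber P)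
      _ ≤ 2 ^ ((κ P : ℝ) + 1) * (D * (τ P * μ P)) := by gcongr; exact hD P (hSF hP) x
      _ = 2 * D * (τ P * (2 ^ (κ P : ℝ) * μ P)) := by rw [two_rpow_add, ENNReal.rpow_one]; ring
      _ ≤ 2 * D * P.indicator (fun _ => τ P * σ P) x := by
          rw [indicator_of_mem hx]
          gcongr
          exact hμ.two_rpow_densityLevel_mul_le hσ (hSF hP)
  · rw [indicator_of_notMem hx, mul_zero]
    refine (Finset.sum_eq_zero fun Q hQ => indicator_of_notMem (fun hxQ => hx ?_) _).le
    exact (mem_below.1 (hfiber P hQ)).2 hxQ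

/-- The off-diagonal energy of the chains of records through a point, see
`sum_le_chainConst_mul_energy`. The values `l` on the smaller and the larger record of a pair enter
with the exponents `c` and `e`. -/
def chainEnergy (F : Finset (Set X)) (κ : Set X → ℤ) (l : Set X → ℝ≥0∞) (c e : ℝ) (x : X) :
    ℝ≥0∞ :=
  ∑ P ∈ records F κ, ∑ Q ∈ below (records F κ) P,
    Q.indicator (fun _ => (2 : ℝ≥0∞) ^ (((κ Q : ℝ) - κ P) / 2) * (l Q ^ c * l P ^ e)) x

omit [MeasurableSpace X] in
lemma sum_records_indicator_le (hF : Laminar F) (κ : Set X → ℤ) (hc : 0 ≤ c) (he : 0 ≤ e)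
    (hq : 0 < q) (hce : c + e = q) (l : Set X → ℝ≥0∞) (x : X) :
    ∑ P ∈ records F κ, P.indicator (fun _ => l P) x ≤
      chainConst q * chainEnergy F κ l c e x ^ (1 / q) := by
  classical
  have hRF := records_subset F κ
  have hinj : InjOn κ ((records F κ).filter (x ∈ ·)) :=
    (records_level_injOn hF κ x).mono fun P hP => Finset.mem_filter.1 hP
  simp only [indicator_apply]
  rw [← Finset.sum_filter]
  refine (sum_le_chainConst_mul_energy hinj hc he hq hce l).trans ?_
  gcongr
  refine (Finset.sum_le_sum fun P hP => ?_).trans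
    (Finset.sum_le_sum_of_subset (Finset.filter_subset _ _))
  obtain ⟨hPR, hxP⟩ := Finset.mem_filter.1 hP
  simp only [indicator_apply]
  rw [← Finset.sum_filter (s := below _ P)]
  refine Finset.sum_le_sum_of_subset fun Q hQ => ?_
  simp only [Finset.mem_filter] at hQ
  obtain ⟨⟨hQR, hxQ⟩, hPQ⟩ := hQ
  refine Finset.mem_filter.2 ⟨mem_below.2 ⟨hQR, ?_⟩, hxQ⟩
  rcases hF.subset_or_ssubset (hRF hQR) (hRF hPR) hxQ hxP with h | h
  · exact h
  · exact absurd hPQ ((mem_records.1 hPR).2 Q (hRF hQR) h).not_ge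

lemma measurable_chainEnergy (hm : ∀ Q ∈ F, MeasurableSet Q) (κ : Set X → ℤ)
    (l : Set X → ℝ≥0∞) (c e : ℝ) : Measurable (chainEnergy F κ l c e) :=
  Finset.measurable_sum _ fun P _ => Finset.measurable_sum _ fun Q hQ =>
    measurable_const.indicator (hm Q (records_subset F κ (below_subset _ P hQ)))

lemma lintegral_chainEnergy_le (hF : Laminar F) (hm : ∀ Q ∈ F, MeasurableSet Q)
    (hμ : Nondegenerate F μ) (hσ : Nondegenerate F σ) {A : ℝ≥0∞}
    (hA : ∀ Q ∈ F, l Q ^ c * w Q ≤ A * μ Q) :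
    ∫⁻ x, chainEnergy F (densityLevel μ σ) l c e x ∂w ≤
      2 * geomConst (1 / 2) * A * ∑ P ∈ records F (densityLevel μ σ), l P ^ e * μ P := by
  set κ := densityLevel μ σ
  have hmB : ∀ P, ∀ Q ∈ below (records F κ) P, MeasurableSet Q := fun P Q hQ =>
    hm Q (records_subset F κ (below_subset _ P hQ))
  simp only [chainEnergy]
  rw [lintegral_finsetSum _ fun P _ => Finset.measurable_sum _ fun Q hQ =>
    measurable_const.indicator (hmB P Q hQ), Finset.mul_sum]
  refine Finset.sum_le_sum fun P hP => ?_
  rw [lintegral_finsetSum _ fun Q hQ => measurable_const.indicator (hmB P Q hQ)]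
  calc ∑ Q ∈ below (records F κ) P, ∫⁻ x, Q.indicator
        (fun _ => (2 : ℝ≥0∞) ^ (((κ Q : ℝ) - κ P) / 2) * (l Q ^ c * l P ^ e)) x ∂w
      ≤ ∑ Q ∈ below (records F κ) P,
          A * l P ^ e * (2 ^ (((κ Q : ℝ) - κ P) / 2) * μ Q) := by
        refine Finset.sum_le_sum fun Q hQ => ?_
        rw [lintegral_indicator (hmB P Q hQ), setLIntegral_const]
        calc 2 ^ (((κ Q : ℝ) - κ P) / 2) * (l Q ^ c * l P ^ e) * w Q
            = 2 ^ (((κ Q : ℝ) - κ P) / 2) * l P ^ e * (l Q ^ c * w Q) := by ring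
          _ ≤ 2 ^ (((κ Q : ℝ) - κ P) / 2) * l P ^ e * (A * μ Q) := by
              exact mul_le_mul_right (hA Q (records_subset F κ (below_subset _ P hQ))) _
          _ = _ := by ring
    _ ≤ A * l P ^ e * (2 * geomConst (1 / 2) * μ P) := by
        rw [← Finset.mul_sum]
        gcongr
        exact sum_below_records_half_le hF hm hμ hσ hP
    _ = 2 * geomConst (1 / 2) * A * (l P ^ e * μ P) := by ring

/-- The constant in `lintegral_dyadicOp_rpow_le_of_slice`. -/
def sliceConst (q : ℝ) : ℝ≥0∞ := chainConst q ^ q * (12 * geomConst (1 / 2))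

lemma sliceConst_ne_top (hq : 0 < q) : sliceConst q ≠ ⊤ :=
  ENNReal.mul_ne_top (ENNReal.rpow_ne_top_of_nonneg hq.le (chainConst_ne_top hq))
    (ENNReal.mul_ne_top ENNReal.ofNat_ne_top (geomConst_ne_top one_half_pos))

lemma lintegral_dyadicOp_rpow_le_of_slice (hF : Laminar F) (hm : ∀ Q ∈ F, MeasurableSet Q)
    (hμ : Nondegenerate F μ) (hσ : Nondegenerate F σ) (hc : 0 ≤ c) (he : 1 ≤ e) (hq : 0 < q)
    (hce : c + e = q) {A B D : ℝ≥0∞}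
    (hD : ∀ P ∈ F, ∀ x, dyadicOp (below F P) τ μ x ≤ D * (τ P * μ P))
    (hA : ∀ Q ∈ F, (τ Q * σ Q) ^ c * w Q ≤ A * μ Q) {M : Set X → X → ℝ≥0∞}
    (hl : ∀ T ∈ F, ∀ P ∈ F, P ⊆ T → ∀ x ∈ P, τ P * σ P ≤ M T x)
    (hM : ∀ T ∈ F, ∫⁻ x in T, M T x ^ e ∂μ ≤ B * σ T ^ e) {R : Set X} (hR : ∀ Q ∈ F, Q ⊆ R) :
    ∫⁻ x, dyadicOp F τ σ x ^ q ∂w ≤ (2 * D) ^ q * sliceConst q * (A * B * σ R ^ e) := by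
  set κ := densityLevel μ σ
  set l : Set X → ℝ≥0∞ := fun Q => τ Q * σ Q
  have hpointwise : ∀ x, dyadicOp F τ σ x ^ q ≤
      (2 * D) ^ q * chainConst q ^ q * chainEnergy F κ l c e x := by
    intro x
    calc dyadicOp F τ σ x ^ q
        ≤ (2 * D * (chainConst q * chainEnergy F κ l c e x ^ (1 / q))) ^ q := by
          gcongr
          refine (dyadicOp_le_dyadicOp_records hF hμ hσ hD x).trans ?_
          gcongr
          exact sum_records_indicator_le hF κ hc (by positivity) hq hce l x
      _ = _ := by
          rw [ENNReal.mul_rpow_of_nonneg (2 * D) _ hq.le,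
            ENNReal.mul_rpow_of_nonneg (chainConst q) _ hq.le, ← ENNReal.rpow_mul,
            one_div_mul_cancel hq.ne', ENNReal.rpow_one, mul_assoc]
  calc ∫⁻ x, dyadicOp F τ σ x ^ q ∂w
      ≤ ∫⁻ x, (2 * D) ^ q * chainConst q ^ q * chainEnergy F κ l c e x ∂w :=
        lintegral_mono hpointwise
    _ = (2 * D) ^ q * chainConst q ^ q * ∫⁻ x, chainEnergy F κ l c e x ∂w :=
        lintegral_const_mul _ (measurable_chainEnergy hm κ l c e)
    _ ≤ (2 * D) ^ q * chainConst q ^ q *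
          (2 * geomConst (1 / 2) * A * (6 * B * σ R ^ e)) := by
        gcongr
        refine (lintegral_chainEnergy_le hF hm hμ hσ hA).trans ?_
        gcongr
        exact sum_records_rpow_le hF hm hμ hσ he hl hM hR
    _ = (2 * D) ^ q * sliceConst q * (A * B * σ R ^ e) := by rw [sliceConst]; ring

end SparseSums

/-! ### Summability of the bump function over dyadic levels -/

section BumpFunction

variable {s : ℝ} {ε : ℝ → ℝ}

/-- The part over `(2 ^ r, 2 ^ (r + 1))` of the integral `∫ dt / (t ε(t) ^ (1 / s))`. -/
def bumpIntegral (s : ℝ) (ε : ℝ → ℝ) (r : ℤ) : ℝ≥0∞ :=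
  ∫⁻ u in Ioo ((2 : ℝ) ^ r) (2 ^ (r + 1)), ENNReal.ofReal (1 / (u * ε u ^ (1 / s)))

/-- The supremum of `ε ^ (-1 / s)` over the dyadic interval `[2 ^ r, 2 ^ (r + 1))`. -/
def bumpWeight (s : ℝ) (ε : ℝ → ℝ) (r : ℤ) : ℝ≥0∞ :=
  ⨆ t ∈ Ico ((2 : ℝ) ^ r) (2 ^ (r + 1)), ENNReal.ofReal (ε t) ^ (-(1 / s))

omit [MeasurableSpace X] in
lemma IsBumpFunction.pos_of_pos (h : IsBumpFunction s ε) {t : ℝ} (ht : 0 < t) : 0 < ε t := by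
  obtain ⟨m, hm, hmε⟩ := h.pos
  exact hm.trans_le (hmε t ht)

lemma IsBumpFunction.tsum_bumpIntegral_ne_top (h : IsBumpFunction s ε) :
    ∑' r, bumpIntegral s ε r ≠ ⊤ := by
  have hdisj : Pairwise (Function.onFun Disjoint fun r : ℤ => Ioo ((2 : ℝ) ^ r) (2 ^ (r + 1))) := by
    intro i j hij
    refine Set.disjoint_left.2 fun u hi hj => hij ?_
    have hlt := hi.1.trans hj.2
    have hgt := hj.1.trans hi.2
    rw [zpow_lt_zpow_iff_right₀ one_lt_two] at hlt hgt
    omega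
  have hfin := h.integrableOn.2
  rw [hasFiniteIntegral_iff_enorm] at hfin
  refine ne_top_of_le_ne_top hfin.ne ?_
  calc ∑' r, bumpIntegral s ε r
      = ∫⁻ u in ⋃ r : ℤ, Ioo ((2 : ℝ) ^ r) (2 ^ (r + 1)),
          ENNReal.ofReal (1 / (u * ε u ^ (1 / s))) :=
        (lintegral_iUnion (fun _ => measurableSet_Ioo) hdisj _).symm
    _ ≤ ∫⁻ u in Ioi 0, ENNReal.ofReal (1 / (u * ε u ^ (1 / s))) :=
        lintegral_mono_set (iUnion_subset fun r u hu => lt_trans (by positivity) hu.1)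
    _ ≤ ∫⁻ u in Ioi 0, ‖1 / (u * ε u ^ (1 / s))‖ₑ :=
        lintegral_mono fun u => Real.ofReal_le_enorm _

lemma ofReal_rpow_le_two_mul_bumpIntegral (hs : 0 < s) (hpos : ∀ t, 0 < t → 0 < ε t) {t : ℝ}
    (ht : 0 < t) {r : ℤ} (h : ∀ u ∈ Ioo ((2 : ℝ) ^ r) (2 ^ (r + 1)), ε u ≤ ε t) :
    ENNReal.ofReal (ε t) ^ (-(1 / s)) ≤ 2 * bumpIntegral s ε r := by
  set a : ℝ := 2 ^ r
  have ha : 0 < a := by positivity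
  have hdouble : (2 : ℝ) ^ (r + 1) = 2 * a := by rw [zpow_add_one₀ two_ne_zero, mul_comm]
  have hlower : ∀ u ∈ Ioo a (2 * a), ENNReal.ofReal (1 / (2 * a) * ε t ^ (-(1 / s))) ≤
      ENNReal.ofReal (1 / (u * ε u ^ (1 / s))) := by
    intro u hu
    have hu0 : 0 < u := ha.trans hu.1
    have hεu := hpos u hu0
    have hut : ε u ≤ ε t := h u (hdouble ▸ hu)
    refine ENNReal.ofReal_le_ofReal ?_
    rw [Real.rpow_neg (hpos t ht).le, ← one_div (ε t ^ _), one_div_mul_one_div]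
    exact one_div_le_one_div_of_le (by positivity) (by gcongr; exact hu.2.le)
  have hscale : 2 * ENNReal.ofReal (1 / (2 * a)) * ENNReal.ofReal (2 * a - a) = 1 := by
    rw [← ENNReal.ofReal_ofNat 2, ← ENNReal.ofReal_mul two_pos.le,
      ← ENNReal.ofReal_mul (by positivity), ← ENNReal.ofReal_one]
    congr 1
    field_simp
    ring
  calc ENNReal.ofReal (ε t) ^ (-(1 / s))
      = 2 * ∫⁻ _ in Ioo a (2 * a), ENNReal.ofReal (1 / (2 * a) * ε t ^ (-(1 / s))) := by
        rw [setLIntegral_const, Real.volume_Ioo, ENNReal.ofReal_mul (by positivity),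
          ENNReal.ofReal_rpow_of_pos (hpos t ht), mul_right_comm, ← mul_assoc, ← mul_assoc,
          hscale, one_mul]
    _ ≤ 2 * bumpIntegral s ε r := by
        rw [bumpIntegral, hdouble]
        gcongr 2 * ?_
        exact setLIntegral_mono' measurableSet_Ioo hlower

lemma IsBumpFunction.bumpWeight_le_of_one_le (h : IsBumpFunction s ε) (hs : 0 < s) {r : ℤ}
    (hr : 1 ≤ r) : bumpWeight s ε r ≤ 2 * bumpIntegral s ε (r - 1) := by
  refine iSup₂_le fun t ht => ?_
  refine ofReal_rpow_le_two_mul_bumpIntegral hs (fun _ => h.pos_of_pos)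
    (lt_of_lt_of_le (by positivity) ht.1) fun u hu => ?_
  have hu1 : 1 < u := (one_le_zpow₀ one_le_two (by omega)).trans_lt hu.1
  have hut : u < t := hu.2.trans_le (by simpa using ht.1)
  exact h.monotoneOn hu1 (hu1.trans hut) hut.le

lemma IsBumpFunction.bumpWeight_le_of_le_neg_two (h : IsBumpFunction s ε) (hs : 0 < s) {r : ℤ}
    (hr : r ≤ -2) : bumpWeight s ε r ≤ 2 * bumpIntegral s ε (r + 1) := by
  refine iSup₂_le fun t ht => ?_
  have ht0 : 0 < t := lt_of_lt_of_le (by positivity) ht.1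
  refine ofReal_rpow_le_two_mul_bumpIntegral hs (fun _ => h.pos_of_pos) ht0 fun u hu => ?_
  have htu : t < u := ht.2.trans hu.1
  have hu1 : u < 1 := hu.2.trans_le (zpow_le_one_of_nonpos₀ one_le_two (by omega))
  exact h.antitoneOn ⟨ht0, htu.trans hu1⟩ ⟨ht0.trans htu, hu1⟩ htu.le

omit [MeasurableSpace X] in
lemma bumpWeight_le_of_le (hs : 0 ≤ s) {m : ℝ} (hm : ∀ t, 0 < t → m ≤ ε t) (r : ℤ) :
    bumpWeight s ε r ≤ ENNReal.ofReal m ^ (-(1 / s)) := by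
  refine iSup₂_le fun t ht => ?_
  rw [ENNReal.rpow_neg, ENNReal.rpow_neg]
  gcongr
  exact hm t (lt_of_lt_of_le (by positivity) ht.1)

lemma IsBumpFunction.tsum_bumpWeight_ne_top (h : IsBumpFunction s ε) (hs : 0 < s) :
    ∑' r, bumpWeight s ε r ≠ ⊤ := by
  obtain ⟨m, hm, hmε⟩ := h.pos
  set b := ENNReal.ofReal m ^ (-(1 / s))
  have hb : b ≠ ⊤ := by
    simp only [b, ENNReal.ofReal_rpow_of_pos hm, ne_eq, ENNReal.ofReal_ne_top, not_false_eq_true]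
  have hle : ∀ r, bumpWeight s ε r ≤ 2 * bumpIntegral s ε (r - 1) +
      2 * bumpIntegral s ε (r + 1) + if r ∈ ({-1, 0} : Finset ℤ) then b else 0 := by
    intro r
    rcases (by omega : 1 ≤ r ∨ r ≤ -2 ∨ (r = -1 ∨ r = 0)) with hr | hr | hr
    · exact (h.bumpWeight_le_of_one_le hs hr).trans (le_add_right (le_add_right le_rfl))
    · exact (h.bumpWeight_le_of_le_neg_two hs hr).trans (le_add_right (le_add_left le_rfl))
    · rw [if_pos (by simpa using hr)]
      exact (bumpWeight_le_of_le hs.le hmε r).trans (le_add_left le_rfl)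
  refine ne_top_of_le_ne_top ?_ (ENNReal.tsum_le_tsum hle)
  rw [ENNReal.tsum_add, ENNReal.tsum_add, ENNReal.tsum_mul_left, ENNReal.tsum_mul_left,
    show ∑' r, bumpIntegral s ε (r - 1) = ∑' r, bumpIntegral s ε r from
      (Equiv.subRight (1 : ℤ)).tsum_eq _,
    show ∑' r, bumpIntegral s ε (r + 1) = ∑' r, bumpIntegral s ε r from
      (Equiv.addRight (1 : ℤ)).tsum_eq _,
    tsum_eq_sum (s := {-1, 0}) fun r hr => if_neg hr]
  have hI := ENNReal.mul_ne_top ENNReal.ofNat_ne_top h.tsum_bumpIntegral_ne_top (a := 2)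
  refine ENNReal.add_ne_top.2 ⟨ENNReal.add_ne_top.2 ⟨hI, hI⟩, ?_⟩
  exact ENNReal.sum_ne_top.2 fun r hr => by rwa [if_pos hr]

omit [MeasurableSpace X] in
lemma inv_le_bumpWeight_level_rpow (hs : 0 < s) {x : ℝ≥0∞} (h0 : x ≠ 0) (ht : x ≠ ⊤) :
    (ENNReal.ofReal (ε x.toReal))⁻¹ ≤ bumpWeight s ε (level x) ^ s := by
  have hx : x.toReal ∈ Ico ((2 : ℝ) ^ level x) (2 ^ (level x + 1)) :=
    ⟨by exact_mod_cast Int.zpow_log_le_self one_lt_two (ENNReal.toReal_pos h0 ht),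
      by exact_mod_cast Int.lt_zpow_succ_log_self one_lt_two x.toReal⟩
  calc (ENNReal.ofReal (ε x.toReal))⁻¹ = (ENNReal.ofReal (ε x.toReal) ^ (-(1 / s))) ^ s := by
        rw [← ENNReal.rpow_mul, neg_mul, one_div_mul_cancel hs.ne', ENNReal.rpow_neg_one]
    _ ≤ bumpWeight s ε (level x) ^ s := by
        gcongr
        exact le_iSup₂ (f := fun t _ => ENNReal.ofReal (ε t) ^ (-(1 / s))) x.toReal hx

end BumpFunction

/-! ### The testing condition from the bump condition -/

section TestingOfBump

variable {F : Finset (Set X)} {μ σ w : Measure X} {τ ρ : Set X → ℝ≥0∞} {p p' q : ℝ} {ε : ℝ → ℝ}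
  {B D : ℝ≥0∞} {M : Set X → X → ℝ≥0∞}

omit [MeasurableSpace X] in
lemma mul_le_of_bump (hq : 0 < q) (hε : ∀ t, 0 < t → 0 < ε t) {a m r v : ℝ≥0∞}
    (hm : m ≠ 0 ∧ m ≠ ⊤) (hr : r ≠ 0 ∧ r ≠ ⊤)
    (h : a * (v / m) * (r * ENNReal.ofReal (ε r.toReal)) ≤ B) :
    a * v ≤ B * bumpWeight q ε (level r) ^ q * 2 ^ (-(level r : ℝ)) * m := by
  set E := ENNReal.ofReal (ε r.toReal)
  have hE : E ≠ 0 := (ENNReal.ofReal_pos.2 (hε _ (ENNReal.toReal_pos hr.1 hr.2))).ne'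
  calc a * v = a * (v / m * m) * (r * r⁻¹) * (E * E⁻¹) := by
        rw [ENNReal.div_mul_cancel hm.1 hm.2, ENNReal.mul_inv_cancel hr.1 hr.2,
          ENNReal.mul_inv_cancel hE ENNReal.ofReal_ne_top, mul_one, mul_one]
    _ = a * (v / m) * (r * E) * E⁻¹ * r⁻¹ * m := by ring
    _ ≤ B * bumpWeight q ε (level r) ^ q * 2 ^ (-(level r : ℝ)) * m := by
        rw [ENNReal.rpow_neg]
        gcongr
        · exact inv_le_bumpWeight_level_rpow hq hr.1 hr.2
        · exact two_rpow_level_le hr.1 hr.2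

lemma lintegral_dyadicOp_rpow_le_of_level (hF : Laminar F) (hm : ∀ Q ∈ F, MeasurableSet Q)
    (hμ : Nondegenerate F μ) (hσ : Nondegenerate F σ) (hp : p.HolderConjugate p') (hpq : p ≤ q)
    (hε : ∀ t, 0 < t → 0 < ε t)
    (hD : ∀ P ∈ F, ∀ x, dyadicOp (below F P) τ μ x ≤ D * (τ P * μ P))
    (hρ : ∀ Q ∈ F, ρ Q ≠ 0 ∧ ρ Q ≠ ⊤)
    (hA : ∀ Q ∈ F, (τ Q * σ Q) ^ (q / p') * (w Q / μ Q) *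
      (ρ Q * ENNReal.ofReal (ε (ρ Q).toReal)) ≤ B)
    (hl : ∀ T ∈ F, ∀ P ∈ F, P ⊆ T → ∀ x ∈ P, τ P * σ P ≤ M T x)
    (hM : ∀ T ∈ F, ∫⁻ x in T, M T x ^ (q / p) ∂μ ≤ ρ T * σ T ^ (q / p))
    {R : Set X} (hR : ∀ Q ∈ F, Q ⊆ R) {r : ℤ} (hr : ∀ Q ∈ F, level (ρ Q) = r) :
    (∫⁻ x, dyadicOp F τ σ x ^ q ∂w) ^ (1 / q) ≤
      2 * (2 * sliceConst q) ^ (1 / q) * D * B ^ (1 / q) * σ R ^ (1 / p) * bumpWeight q ε r := by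
  have hq : 0 < q := hp.pos.trans_le hpq
  have hexp : q / p' + q / p = q := by
    rw [div_eq_mul_inv, div_eq_mul_inv, ← mul_add, add_comm, hp.inv_add_inv_eq_one, mul_one]
  have hslice := lintegral_dyadicOp_rpow_le_of_slice hF hm hμ hσ (w := w)
    (div_nonneg hq.le hp.symm.nonneg) ((one_le_div hp.pos).2 hpq) hq hexp hD
    (A := B * bumpWeight q ε r ^ q * 2 ^ (-(r : ℝ))) (B := 2 ^ ((r : ℝ) + 1))
    (fun Q hQ => hr Q hQ ▸ mul_le_of_bump hq hε (hμ Q hQ) (hρ Q hQ) (hA Q hQ)) hl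
    (fun T hT => (hM T hT).trans (mul_le_mul_left
      (hr T hT ▸ (lt_two_rpow_level_add_one (hρ T hT).2).le) _)) hR
  have hconst : (2 * D) ^ q * sliceConst q * (B * bumpWeight q ε r ^ q * 2 ^ (-(r : ℝ)) *
      2 ^ ((r : ℝ) + 1) * σ R ^ (q / p)) =
      (2 * D) ^ q * (2 * sliceConst q) * B * σ R ^ (q / p) * bumpWeight q ε r ^ q := by
    have htwo : (2 : ℝ≥0∞) ^ (-(r : ℝ)) * 2 ^ ((r : ℝ) + 1) = 2 := by
      rw [← two_rpow_add, neg_add_cancel_left, ENNReal.rpow_one]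
    rw [mul_assoc (B * _), htwo]
    ring
  have h0 : 0 ≤ 1 / q := by positivity
  refine (ENNReal.rpow_le_rpow (hslice.trans_eq hconst) h0).trans_eq ?_
  rw [ENNReal.mul_rpow_of_nonneg _ _ h0, ENNReal.mul_rpow_of_nonneg _ _ h0,
    ENNReal.mul_rpow_of_nonneg _ _ h0, ENNReal.mul_rpow_of_nonneg _ _ h0, ← ENNReal.rpow_mul,
    ← ENNReal.rpow_mul, ← ENNReal.rpow_mul, mul_one_div_cancel hq.ne', ENNReal.rpow_one,
    ENNReal.rpow_one, show q / p * (1 / q) = 1 / p by field_simp]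
  ring

/-- The constant in `testing_of_bump`. -/
def bumpConst (q : ℝ) (ε : ℝ → ℝ) : ℝ≥0∞ :=
  2 * (2 * sliceConst q) ^ (1 / q) * ∑' r, bumpWeight q ε r

lemma IsBumpFunction.bumpConst_ne_top (h : IsBumpFunction q ε) (hq : 0 < q) :
    bumpConst q ε ≠ ⊤ :=
  ENNReal.mul_ne_top (ENNReal.mul_ne_top ENNReal.ofNat_ne_top (ENNReal.rpow_ne_top_of_nonneg
    (by positivity) (ENNReal.mul_ne_top ENNReal.ofNat_ne_top (sliceConst_ne_top hq))))
    (h.tsum_bumpWeight_ne_top hq)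

theorem testing_of_bump (hF : Laminar F) (hm : ∀ Q ∈ F, MeasurableSet Q)
    (hμ : Nondegenerate F μ) (hσ : Nondegenerate F σ) (hp : p.HolderConjugate p') (hpq : p ≤ q)
    (hε : ∀ t, 0 < t → 0 < ε t)
    (hD : ∀ P ∈ F, ∀ x, dyadicOp (below F P) τ μ x ≤ D * (τ P * μ P))
    (hρ : ∀ Q ∈ F, ρ Q ≠ 0 ∧ ρ Q ≠ ⊤)
    (hA : ∀ Q ∈ F, (τ Q * σ Q) ^ (q / p') * (w Q / μ Q) *
      (ρ Q * ENNReal.ofReal (ε (ρ Q).toReal)) ≤ B)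
    (hl : ∀ T ∈ F, ∀ P ∈ F, P ⊆ T → ∀ x ∈ P, τ P * σ P ≤ M T x)
    (hM : ∀ T ∈ F, ∫⁻ x in T, M T x ^ (q / p) ∂μ ≤ ρ T * σ T ^ (q / p)) :
    Testing F τ σ w p q (bumpConst q ε * D * B ^ (1 / q)) := by
  classical
  intro R _
  set G := below F R
  set slice : ℤ → Finset (Set X) := fun r => G.filter fun Q => level (ρ Q) = r
  have hGF : G ⊆ F := below_subset F R
  have hsliceF : ∀ r, slice r ⊆ F := fun r => (Finset.filter_subset _ _).trans hGF
  have hsum : ∀ x, dyadicOp G τ σ x =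
      ∑ r ∈ G.image fun Q => level (ρ Q), dyadicOp (slice r) τ σ x := fun x =>
    (Finset.sum_fiberwise_of_maps_to (fun Q hQ => Finset.mem_image_of_mem _ hQ) _).symm
  set c := 2 * (2 * sliceConst q) ^ (1 / q) * D * B ^ (1 / q) * σ R ^ (1 / p)
  have hslice : ∀ r, (∫⁻ x, dyadicOp (slice r) τ σ x ^ q ∂w) ^ (1 / q) ≤ c * bumpWeight q ε r :=
    fun r => lintegral_dyadicOp_rpow_le_of_level (hF.mono (hsliceF r))
      (fun Q hQ => hm Q (hsliceF r hQ)) (hμ.mono (hsliceF r)) (hσ.mono (hsliceF r)) hp hpq hε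
      (fun P hP x => (dyadicOp_mono (Finset.filter_subset_filter _ (hsliceF r)) τ μ x).trans
        (hD P (hsliceF r hP) x))
      (fun Q hQ => hρ Q (hsliceF r hQ)) (fun Q hQ => hA Q (hsliceF r hQ))
      (fun T hT P hP => hl T (hsliceF r hT) P (hsliceF r hP))
      (fun T hT => hM T (hsliceF r hT))
      (fun Q hQ => (mem_below.1 (Finset.mem_of_mem_filter Q hQ)).2)
      (fun Q hQ => (Finset.mem_filter.1 hQ).2)
  calc (∫⁻ x, dyadicOp G τ σ x ^ q ∂w) ^ (1 / q)
      ≤ ∑ r ∈ G.image fun Q => level (ρ Q), (∫⁻ x, dyadicOp (slice r) τ σ x ^ q ∂w) ^ (1 / q) := by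
        simp only [hsum]
        exact lintegral_rpow_finsetSum_le w (fun r _ => measurable_dyadicOp
          (fun Q hQ => hm Q (hsliceF r hQ)) τ σ) (hp.lt.le.trans hpq)
    _ ≤ ∑ r ∈ G.image fun Q => level (ρ Q), c * bumpWeight q ε r :=
        Finset.sum_le_sum fun r _ => hslice r
    _ ≤ c * ∑' r, bumpWeight q ε r := by
        rw [← Finset.mul_sum]
        gcongr
        exact ENNReal.sum_le_tsum _
    _ = bumpConst q ε * D * B ^ (1 / q) * σ R ^ (1 / p) := by rw [bumpConst]; ring

end TestingOfBump

/-! ### Dyadic grids and the one-third trick -/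

section Grid

variable {n N : ℕ} {α : ℝ} {v : Fin n → ℝ} {j k : ℤ} {m m' : Fin n → ℤ}
  {x y : EuclideanSpace ℝ (Fin n)} {P Q : Set (EuclideanSpace ℝ (Fin n))}

lemma measurableSet_cube (a : EuclideanSpace ℝ (Fin n)) (l : ℝ) : MeasurableSet (cube a l) := by
  simp only [cube, ofPred_forall]
  exact MeasurableSet.iInter fun i => measurableSet_Ico.preimage (by fun_prop)

lemma volume_cube (a : EuclideanSpace ℝ (Fin n)) (l : ℝ) :
    volume (cube a l) = ENNReal.ofReal l ^ n := by
  have h : cube a l = (MeasurableEquiv.toLp 2 (Fin n → ℝ)).symm ⁻¹'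
      (Set.univ.pi fun i => Ico (a i) (a i + l)) := by
    ext x
    simp [cube]
  rw [h,
    (EuclideanSpace.volume_preserving_symm_measurableEquiv_toLp (Fin n)).measure_preimage_equiv,
    Real.volume_pi_Ico]
  simp

/-- The cube of side length `2 ^ j` with index `m` in the dyadic grid with origin `v`. -/
def dyadicCube (v : Fin n → ℝ) (j : ℤ) (m : Fin n → ℤ) : Set (EuclideanSpace ℝ (Fin n)) :=
  cube (WithLp.toLp 2 fun i => v i + m i * 2 ^ j) (2 ^ j)

lemma mem_dyadicCube : x ∈ dyadicCube v j m ↔ ∀ i, ⌊(x i - v i) / 2 ^ j⌋ = m i := by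
  have h2 : (0 : ℝ) < 2 ^ j := by positivity
  refine forall_congr' fun i => ?_
  rw [Int.floor_eq_iff, le_div_iff₀ h2, div_lt_iff₀ h2]
  simp only [mem_Ico]
  constructor <;> rintro ⟨h, h'⟩ <;> constructor <;> linarith

lemma volume_dyadicCube (v : Fin n → ℝ) (j : ℤ) (m : Fin n → ℤ) :
    volume (dyadicCube v j m) = (2 ^ (j : ℝ)) ^ n := by
  rw [dyadicCube, volume_cube, two_rpow_intCast]

lemma floor_div_two_zpow_congr {s t : ℝ} (hjk : j ≤ k) (h : ⌊s / 2 ^ j⌋ = ⌊t / 2 ^ j⌋) :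
    ⌊s / 2 ^ k⌋ = ⌊t / 2 ^ k⌋ := by
  obtain ⟨d, rfl⟩ := Int.le.dest hjk
  have hdiv : ∀ u : ℝ, u / 2 ^ (j + d) = u / 2 ^ j / ((2 ^ d : ℕ) : ℝ) := fun u => by
    rw [zpow_add₀ two_ne_zero, div_div, zpow_natCast, Nat.cast_pow, Nat.cast_ofNat]
  rw [hdiv, hdiv, Int.floor_div_natCast, Int.floor_div_natCast, h]

lemma dyadicCube_subset_of_le (hjk : j ≤ k) (hx : x ∈ dyadicCube v j m)
    (hx' : x ∈ dyadicCube v k m') : dyadicCube v j m ⊆ dyadicCube v k m' := by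
  intro y hy
  rw [mem_dyadicCube] at *
  intro i
  rw [← hx' i]
  exact floor_div_two_zpow_congr hjk ((hy i).trans (hx i).symm)

open Classical in
/-- A finite part of the dyadic grid with origin `v`, which exhausts the grid as `N → ∞`: the cubes
of side lengths `2 ^ j`, `|j| ≤ N`, whose indices are bounded by `4 ^ (N + 1)`. -/
def grid (v : Fin n → ℝ) (N : ℕ) : Finset (Set (EuclideanSpace ℝ (Fin n))) :=
  ((Finset.Icc (-(N : ℤ)) N) ×ˢ
    Fintype.piFinset fun _ : Fin n => Finset.Icc (-(4 : ℤ) ^ (N + 1)) (4 ^ (N + 1))).image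
    fun z => dyadicCube v z.1 z.2

lemma mem_grid : Q ∈ grid v N ↔ ∃ j m, (-(N : ℤ) ≤ j ∧ j ≤ N) ∧
    (∀ i, -(4 : ℤ) ^ (N + 1) ≤ m i ∧ m i ≤ 4 ^ (N + 1)) ∧ dyadicCube v j m = Q := by
  simp only [grid, Finset.mem_image, Finset.mem_product, Finset.mem_Icc, Fintype.mem_piFinset,
    Prod.exists, and_assoc]

lemma exists_eq_cube_of_mem_grid (hQ : Q ∈ grid v N) : ∃ a l, 0 < l ∧ cube a l = Q := by
  obtain ⟨j, m, -, -, rfl⟩ := mem_grid.1 hQ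
  exact ⟨_, _, by positivity, rfl⟩

lemma measurableSet_of_mem_grid (hQ : Q ∈ grid v N) : MeasurableSet Q := by
  obtain ⟨a, l, -, rfl⟩ := exists_eq_cube_of_mem_grid hQ
  exact measurableSet_cube a l

lemma laminar_grid (v : Fin n → ℝ) (N : ℕ) : Laminar (grid v N) := by
  intro P hP Q hQ
  obtain ⟨j, m, -, -, rfl⟩ := mem_grid.1 hP
  obtain ⟨k, m', -, -, rfl⟩ := mem_grid.1 hQ
  by_cases h : Disjoint (dyadicCube v j m) (dyadicCube v k m')
  · exact Or.inr (Or.inr h)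
  obtain ⟨x, hx, hx'⟩ := Set.not_disjoint_iff.1 h
  rcases le_total j k with hjk | hkj
  · exact Or.inl (dyadicCube_subset_of_le hjk hx hx')
  · exact Or.inr (Or.inl (dyadicCube_subset_of_le hkj hx' hx))

lemma nondegenerate_grid_volume (v : Fin n → ℝ) (N : ℕ) : Nondegenerate (grid v N) volume := by
  intro Q hQ
  obtain ⟨j, m, -, -, rfl⟩ := mem_grid.1 hQ
  rw [volume_dyadicCube]
  exact ⟨pow_ne_zero _ (two_rpow_ne_zero _), ENNReal.pow_ne_top (two_rpow_ne_top _)⟩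

/-- The dyadic level of the side length of a cube. -/
def sideLevel (Q : Set (EuclideanSpace ℝ (Fin n))) : ℤ := level (volume Q ^ (1 / (n : ℝ)))

lemma volume_dyadicCube_rpow (hn : n ≠ 0) (v : Fin n → ℝ) (j : ℤ) (m : Fin n → ℤ) :
    volume (dyadicCube v j m) ^ (1 / (n : ℝ)) = 2 ^ (j : ℝ) := by
  rw [volume_dyadicCube, one_div, ENNReal.pow_rpow_inv_natCast hn]

lemma sideLevel_dyadicCube (hn : n ≠ 0) (v : Fin n → ℝ) (j : ℤ) (m : Fin n → ℤ) :
    sideLevel (dyadicCube v j m) = j := by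
  rw [sideLevel, volume_dyadicCube_rpow hn, level, two_rpow_intCast,
    ENNReal.toReal_ofReal (by positivity)]
  exact Int.log_zpow one_lt_two j

lemma two_rpow_sideLevel (hn : n ≠ 0) (hQ : Q ∈ grid v N) :
    (2 : ℝ≥0∞) ^ (sideLevel Q : ℝ) = volume Q ^ (1 / (n : ℝ)) := by
  obtain ⟨j, m, -, -, rfl⟩ := mem_grid.1 hQ
  rw [sideLevel_dyadicCube hn, volume_dyadicCube_rpow hn]

lemma sideLevel_injOn (hn : n ≠ 0) (v : Fin n → ℝ) (N : ℕ) (x : EuclideanSpace ℝ (Fin n)) :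
    InjOn sideLevel {Q | Q ∈ grid v N ∧ x ∈ Q} := by
  rintro P ⟨hP, hxP⟩ Q ⟨hQ, hxQ⟩ h
  obtain ⟨j, m, -, -, rfl⟩ := mem_grid.1 hP
  obtain ⟨k, m', -, -, rfl⟩ := mem_grid.1 hQ
  simp only [sideLevel_dyadicCube hn] at h
  exact (dyadicCube_subset_of_le h.le hxP hxQ).antisymm (dyadicCube_subset_of_le h.ge hxQ hxP)

/-- The coefficient `|Q| ^ (α / n - 1)` of the fractional integral. -/
def fracCoeff (α : ℝ) (Q : Set (EuclideanSpace ℝ (Fin n))) : ℝ≥0∞ := volume Q ^ (α / n - 1)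

lemma fracCoeff_ne_zero_and_ne_top (hQ : Q ∈ grid v N) (α : ℝ) :
    fracCoeff α Q ≠ 0 ∧ fracCoeff α Q ≠ ⊤ := by
  obtain ⟨h0, ht⟩ := nondegenerate_grid_volume v N Q hQ
  exact ⟨(ENNReal.rpow_pos (pos_iff_ne_zero.2 h0) ht).ne', ENNReal.rpow_ne_top_of_ne_zero h0 ht⟩

lemma fracCoeff_mul_volume (hQ : Q ∈ grid v N) (α : ℝ) :
    fracCoeff α Q * volume Q = (volume Q ^ (1 / (n : ℝ))) ^ α := by
  obtain ⟨h0, ht⟩ := nondegenerate_grid_volume v N Q hQ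
  rw [fracCoeff, ENNReal.rpow_sub _ _ h0 ht, ENNReal.rpow_one, ENNReal.div_mul_cancel h0 ht,
    ← ENNReal.rpow_mul, one_div_mul_eq_div]

lemma fracCoeff_dyadicCube (hn : n ≠ 0) (α : ℝ) (v : Fin n → ℝ) (j : ℤ) (m : Fin n → ℤ) :
    fracCoeff α (dyadicCube v j m) = (2 ^ (j : ℝ)) ^ (-(n - α)) := by
  rw [fracCoeff, volume_dyadicCube, ← ENNReal.rpow_natCast, ← ENNReal.rpow_mul]
  congr 1
  field_simp
  ring

lemma dyadicOp_below_volume_le (hn : n ≠ 0) (hα : 0 < α)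
    {F : Finset (Set (EuclideanSpace ℝ (Fin n)))} (hF : F ⊆ grid v N) (hP : P ∈ F)
    (x : EuclideanSpace ℝ (Fin n)) :
    dyadicOp (below F P) (fracCoeff α) volume x ≤ geomConst α * (fracCoeff α P * volume P) := by
  classical
  set s := (below F P).filter (x ∈ ·)
  have hs : ∀ Q ∈ s, (Q ∈ grid v N ∧ x ∈ Q) ∧ Q ⊆ P := fun Q hQ => by
    obtain ⟨hQ, hx⟩ := Finset.mem_filter.1 hQ
    exact ⟨⟨hF (mem_below.1 hQ).1, hx⟩, (mem_below.1 hQ).2⟩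
  calc dyadicOp (below F P) (fracCoeff α) volume x
      = ∑ Q ∈ s, (2 : ℝ≥0∞) ^ ((sideLevel Q : ℝ) * α) := by
        simp only [dyadicOp, indicator_apply]
        rw [← Finset.sum_filter]
        refine Finset.sum_congr rfl fun Q hQ => ?_
        rw [fracCoeff_mul_volume (hs Q hQ).1.1, ENNReal.rpow_mul,
          two_rpow_sideLevel hn (hs Q hQ).1.1]
    _ ≤ geomConst α * (volume P ^ (1 / (n : ℝ))) ^ α := by
        refine sum_two_rpow_le_rpow ((sideLevel_injOn hn v N x).mono fun Q hQ => (hs Q hQ).1) hα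
          fun Q hQ => ?_
        rw [two_rpow_sideLevel hn (hs Q hQ).1.1]
        gcongr
        exact (hs Q hQ).2
    _ = geomConst α * (fracCoeff α P * volume P) := by rw [fracCoeff_mul_volume (hF hP)]

-- If both pairs of floors differ, then `2 ^ k` is a multiple of `3`.
lemma floor_eq_or_floor_sub_third_eq {s t : ℝ} (h : |s - t| < 1 / 3) (k : ℕ) :
    ⌊s⌋ = ⌊t⌋ ∨ ⌊s - 2 ^ k / 3⌋ = ⌊t - 2 ^ k / 3⌋ := by
  wlog hst : s ≤ t generalizing s t
  · exact (this (by rwa [abs_sub_comm]) (le_of_not_ge hst)).imp Eq.symm Eq.symm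
  by_contra! hne
  have hs : s < ⌊t⌋ := Int.floor_lt.1 ((Int.floor_mono hst).lt_of_ne hne.1)
  have hs' : s - 2 ^ k / 3 < ⌊t - 2 ^ k / 3⌋ :=
    Int.floor_lt.1 ((Int.floor_mono (by linarith)).lt_of_ne hne.2)
  have ht := Int.floor_le t
  have ht' := Int.floor_le (t - 2 ^ k / 3)
  rw [abs_lt] at h
  set a := ⌊t⌋
  set b := ⌊t - 2 ^ k / 3⌋
  have hlt : (2 : ℤ) ^ k < 3 * (a - b) + 1 := by
    have : (2 : ℝ) ^ k < 3 * (a - b) + 1 := by linarith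
    exact_mod_cast this
  have hgt : 3 * (a - b) - 1 < (2 : ℤ) ^ k := by
    have : 3 * ((a : ℝ) - b) - 1 < 2 ^ k := by linarith
    exact_mod_cast this
  have heq : (2 : ℤ) ^ k = 3 * (a - b) := by omega
  have hdvd : (3 : ℤ) ∣ 2 := Int.Prime.dvd_pow' (p := 3) Nat.prime_three ⟨a - b, heq⟩
  norm_num at hdvd

/-- The origins of the `2 ^ n` shifted grids of the one-third trick. Measured in
units of a side length `2 ^ j` of `grid v N`, the shift `2 ^ N / 3` is one third of a power of `2`,
hence at distance `1 / 3` from the integers. -/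
def shift (N : ℕ) (θ : Fin n → Bool) (i : Fin n) : ℝ := if θ i then 2 ^ N / 3 else 0

lemma abs_shift_le (N : ℕ) (θ : Fin n → Bool) (i : Fin n) : |shift N θ i| ≤ 2 ^ N := by
  have h2 : (0 : ℝ) < 2 ^ N := by positivity
  rw [shift]
  split_ifs
  · rw [abs_of_pos (by positivity)]
    linarith
  · rw [abs_zero]
    exact h2.le

lemma exists_floor_shift_eq (hj : j ≤ N) (hxy : ∀ i, 3 * |x i - y i| < 2 ^ j) :
    ∃ θ : Fin n → Bool, ∀ i,
      ⌊(x i - shift N θ i) / 2 ^ j⌋ = ⌊(y i - shift N θ i) / 2 ^ j⌋ := by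
  have h2 : (0 : ℝ) < 2 ^ j := by positivity
  obtain ⟨k, hk⟩ := Int.le.dest hj
  have hrescale : ∀ u : ℝ, (u - 2 ^ N / 3) / 2 ^ j = u / 2 ^ j - 2 ^ k / 3 := fun u => by
    have : (2 : ℝ) ^ N = 2 ^ j * 2 ^ k := by
      rw [← zpow_natCast, ← zpow_natCast, ← zpow_add₀ two_ne_zero, hk]
    rw [this]
    field_simp
  have hcoord : ∀ i, ∃ b : Bool, ⌊(x i - if b then (2 : ℝ) ^ N / 3 else 0) / 2 ^ j⌋ =
      ⌊(y i - if b then (2 : ℝ) ^ N / 3 else 0) / 2 ^ j⌋ := by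
    intro i
    have hclose : |x i / 2 ^ j - y i / 2 ^ j| < 1 / 3 := by
      rw [← sub_div, abs_div, abs_of_pos h2, div_lt_iff₀ h2]
      linarith [hxy i]
    rcases floor_eq_or_floor_sub_third_eq hclose k with h | h
    · exact ⟨false, by simpa using h⟩
    · exact ⟨true, by simpa [hrescale] using h⟩
  choose θ hθ using hcoord
  exact ⟨θ, hθ⟩

lemma floor_div_two_zpow_mem {s c : ℝ} (hj : -(N : ℤ) ≤ j) (hs : |s| ≤ 2 ^ N) (hc : |c| ≤ 2 ^ N) :
    -(4 : ℤ) ^ (N + 1) ≤ ⌊(s - c) / 2 ^ j⌋ ∧ ⌊(s - c) / 2 ^ j⌋ ≤ 4 ^ (N + 1) := by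
  have h2 : (0 : ℝ) < 2 ^ j := by positivity
  have hbound : |(s - c) / 2 ^ j| ≤ 4 ^ (N + 1) := by
    rw [abs_div, abs_of_pos h2, div_le_iff₀ h2]
    have hscale : (1 : ℝ) ≤ 2 ^ N * 2 ^ j := by
      rw [← zpow_natCast, ← zpow_add₀ two_ne_zero]
      exact one_le_zpow₀ one_le_two (by omega)
    calc |s - c| ≤ 2 ^ N + 2 ^ N := (abs_sub s c).trans (add_le_add hs hc)
      _ ≤ 4 * 2 ^ N * 1 := by linarith [pow_pos (zero_lt_two' ℝ) N]
      _ ≤ 4 * 2 ^ N * (2 ^ N * 2 ^ j) := by gcongr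
      _ = 4 ^ (N + 1) * 2 ^ j := by
        rw [pow_succ, show (4 : ℝ) = 2 * 2 by norm_num, mul_pow]
        ring
  rw [abs_le] at hbound
  refine ⟨Int.le_floor.2 (by exact_mod_cast hbound.1), ?_⟩
  exact_mod_cast (Int.floor_le _).trans hbound.2

lemma exists_dyadicCube_mem_grid_shift (hj : -(N : ℤ) ≤ j ∧ j ≤ N)
    (hxy : ∀ i, 3 * |x i - y i| < 2 ^ j) (hx : ∀ i, |x i| ≤ 2 ^ N) :
    ∃ (θ : Fin n → Bool) (m : Fin n → ℤ), dyadicCube (shift N θ) j m ∈ grid (shift N θ) N ∧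
      x ∈ dyadicCube (shift N θ) j m ∧ y ∈ dyadicCube (shift N θ) j m := by
  obtain ⟨θ, hθ⟩ := exists_floor_shift_eq hj.2 hxy
  refine ⟨θ, fun i => ⌊(x i - shift N θ i) / 2 ^ j⌋, mem_grid.2 ⟨j, _, hj, fun i => ?_, rfl⟩,
    mem_dyadicCube.2 fun i => rfl, mem_dyadicCube.2 fun i => (hθ i).symm⟩
  exact floor_div_two_zpow_mem hj.1 (hx i) (abs_shift_le N θ i)

end Grid

/-! ### Dyadic domination of the fractional integral -/

section DyadicKernel

variable {F : Finset (Set X)}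

/-- The kernel `∑ τ_Q 1_Q(x) 1_Q(y)` of the positive dyadic operator `dyadicOp F τ`. -/
def dyadicKernel (F : Finset (Set X)) (τ : Set X → ℝ≥0∞) (x y : X) : ℝ≥0∞ :=
  ∑ Q ∈ F, Q.indicator (fun _ => Q.indicator (fun _ => τ Q) y) x

lemma measurable_indicator_indicator {Q : Set X} (hQ : MeasurableSet Q) (c : ℝ≥0∞) (x : X) :
    Measurable fun y => Q.indicator (fun _ => Q.indicator (fun _ => c) y) x := by
  by_cases hx : x ∈ Q
  · simpa only [indicator_of_mem hx] using measurable_const.indicator hQ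
  · simpa only [indicator_of_notMem hx] using measurable_const

lemma measurable_dyadicKernel (hm : ∀ Q ∈ F, MeasurableSet Q) (τ : Set X → ℝ≥0∞) (x : X) :
    Measurable (dyadicKernel F τ x) :=
  Finset.measurable_sum _ fun Q hQ => measurable_indicator_indicator (hm Q hQ) _ x

lemma lintegral_dyadicKernel (hm : ∀ Q ∈ F, MeasurableSet Q) (τ : Set X → ℝ≥0∞) (μ : Measure X)
    (x : X) : ∫⁻ y, dyadicKernel F τ x y ∂μ = dyadicOp F τ μ x := by
  simp only [dyadicKernel, dyadicOp]
  rw [lintegral_finsetSum _ fun Q hQ => measurable_indicator_indicator (hm Q hQ) _ x]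
  refine Finset.sum_congr rfl fun Q hQ => ?_
  by_cases hx : x ∈ Q
  · simp only [indicator_of_mem hx]
    exact lintegral_indicator_const (hm Q hQ) _
  · simp only [indicator_of_notMem hx, lintegral_zero]

omit [MeasurableSpace X] in
lemma le_dyadicKernel {τ : Set X → ℝ≥0∞} {Q : Set X} (hQ : Q ∈ F) {x y : X} (hx : x ∈ Q)
    (hy : y ∈ Q) : τ Q ≤ dyadicKernel F τ x y := by
  refine le_trans (le_of_eq ?_) (Finset.single_le_sum (fun _ _ => zero_le) hQ)
  rw [indicator_of_mem hx, indicator_of_mem hy]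

end DyadicKernel

section FracPot

variable {n : ℕ} {α : ℝ}

/-- The kernel `|y - x| ^ (α - n)` of the fractional integral, in `[0, ∞)`. On the diagonal its
value is the junk value `0`. -/
def potKernel (α : ℝ) (x y : EuclideanSpace ℝ (Fin n)) : ℝ≥0∞ :=
  ENNReal.ofReal (‖y - x‖ ^ ((n : ℝ) - α))⁻¹

/-- The fractional integral of a measure. -/
def fracPot (α : ℝ) (μ : Measure (EuclideanSpace ℝ (Fin n))) (x : EuclideanSpace ℝ (Fin n)) :
    ℝ≥0∞ := ∫⁻ y, potKernel α x y ∂μ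

lemma measurable_uncurry_potKernel (α : ℝ) :
    Measurable (Function.uncurry (potKernel (n := n) α)) := by
  unfold potKernel Function.uncurry
  fun_prop

lemma measurable_fracPot (α : ℝ) (μ : Measure (EuclideanSpace ℝ (Fin n))) [SFinite μ] :
    Measurable (fracPot α μ) :=
  (measurable_uncurry_potKernel α).lintegral_prod_right'

lemma ofReal_inv_rpow_le {r β : ℝ} (hr : 0 < r) (hβ : 0 ≤ β) {j : ℤ} (hj : 2 ^ j ≤ 8 * r) :
    ENNReal.ofReal (r ^ β)⁻¹ ≤ 8 ^ β * (2 ^ (j : ℝ)) ^ (-β) := by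
  have h8 : (2 : ℝ≥0∞) ^ (j : ℝ) ≤ 8 * ENNReal.ofReal r := by
    rw [two_rpow_intCast, ← ENNReal.ofReal_ofNat, ← ENNReal.ofReal_mul (by norm_num)]
    exact ENNReal.ofReal_le_ofReal hj
  calc ENNReal.ofReal (r ^ β)⁻¹ = ENNReal.ofReal r ^ (-β) := by
        rw [ENNReal.ofReal_rpow_of_pos hr, Real.rpow_neg hr.le]
    _ = 8 ^ β * (8 * ENNReal.ofReal r) ^ (-β) := by
        rw [ENNReal.mul_rpow_of_ne_top ENNReal.ofNat_ne_top ENNReal.ofReal_ne_top, ← mul_assoc,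
          ← ENNReal.rpow_add _ _ (by norm_num) ENNReal.ofNat_ne_top, add_neg_cancel,
          ENNReal.rpow_zero, one_mul]
    _ ≤ 8 ^ β * (2 ^ (j : ℝ)) ^ (-β) := by
        rw [ENNReal.rpow_neg, ENNReal.rpow_neg]
        gcongr

open Filter in
lemma eventually_potKernel_le (hn : n ≠ 0) (hα : α < n) (x y : EuclideanSpace ℝ (Fin n)) :
    ∀ᶠ N : ℕ in atTop, potKernel α x y ≤ 8 ^ (n - α) *
      ∑ θ : Fin n → Bool, dyadicKernel (grid (shift N θ) N) (fracCoeff α) x y := by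
  have hpos : 0 < (n : ℝ) - α := by linarith
  rcases eq_or_ne x y with rfl | hxy
  · simp [potKernel, Real.zero_rpow hpos.ne']
  have hr : 0 < ‖y - x‖ := norm_pos_iff.2 (sub_ne_zero.2 hxy.symm)
  obtain ⟨k, hk, hk'⟩ :=
    exists_mem_Ico_zpow (x := 3 * ‖y - x‖) (by positivity) (one_lt_two (α := ℝ))
  have hclose : ∀ i, 3 * |x i - y i| < 2 ^ (k + 1) := fun i => by
    have h := PiLp.norm_apply_le (y - x) i
    rw [PiLp.sub_apply, Real.norm_eq_abs, abs_sub_comm] at h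
    linarith
  have hside : (2 : ℝ) ^ (k + 1) ≤ 8 * ‖y - x‖ := by
    rw [zpow_add_one₀ two_ne_zero]
    linarith
  obtain ⟨N₀, hN₀⟩ := pow_unbounded_of_one_lt ‖x‖ (one_lt_two (α := ℝ))
  filter_upwards [eventually_ge_atTop N₀, eventually_ge_atTop (k + 1).natAbs] with N hN hkN
  have hx : ∀ i, |x i| ≤ 2 ^ N := fun i =>
    (PiLp.norm_apply_le x i).trans (hN₀.le.trans (pow_le_pow_right₀ one_le_two hN))
  obtain ⟨θ, m, hQ, hxQ, hyQ⟩ := exists_dyadicCube_mem_grid_shift (by omega) hclose hx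
  calc potKernel α x y ≤ 8 ^ (n - α) * fracCoeff α (dyadicCube (shift N θ) (k + 1) m) := by
        rw [fracCoeff_dyadicCube hn]
        exact ofReal_inv_rpow_le hr hpos.le hside
    _ ≤ 8 ^ (n - α) * ∑ θ : Fin n → Bool,
          dyadicKernel (grid (shift N θ) N) (fracCoeff α) x y := by
        gcongr
        exact (le_dyadicKernel hQ hxQ hyQ).trans
          (Finset.single_le_sum (f := fun θ => dyadicKernel (grid (shift N θ) N) (fracCoeff α) x y)
            (fun _ _ => zero_le) (Finset.mem_univ θ))

open Filter in
lemma fracPot_le_liminf (hn : n ≠ 0) (hα : α < n) (μ : Measure (EuclideanSpace ℝ (Fin n)))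
    (x : EuclideanSpace ℝ (Fin n)) :
    fracPot α μ x ≤ liminf (fun N : ℕ => 8 ^ (n - α) *
      ∑ θ : Fin n → Bool, dyadicOp (grid (shift N θ) N) (fracCoeff α) μ x) atTop := by
  have hm : ∀ (N : ℕ) (θ : Fin n → Bool),
      Measurable (dyadicKernel (grid (shift N θ) N) (fracCoeff α) x) := fun N θ =>
    measurable_dyadicKernel (fun _ => measurableSet_of_mem_grid) _ x
  calc fracPot α μ x
      ≤ ∫⁻ y, liminf (fun N : ℕ => 8 ^ (n - α) *
          ∑ θ : Fin n → Bool, dyadicKernel (grid (shift N θ) N) (fracCoeff α) x y) atTop ∂μ :=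
        lintegral_mono fun y =>
          le_liminf_of_le (by isBoundedDefault) (eventually_potKernel_le hn hα x y)
    _ ≤ liminf (fun N : ℕ => ∫⁻ y, 8 ^ (n - α) *
          ∑ θ : Fin n → Bool, dyadicKernel (grid (shift N θ) N) (fracCoeff α) x y ∂μ) atTop :=
        lintegral_liminf_le fun N =>
          (Finset.measurable_sum _ fun θ _ => hm N θ).const_mul _
    _ = liminf (fun N : ℕ => 8 ^ (n - α) *
          ∑ θ : Fin n → Bool, dyadicOp (grid (shift N θ) N) (fracCoeff α) μ x) atTop := by
        congr 1 with N
        rw [lintegral_const_mul _ (Finset.measurable_sum _ fun θ _ => hm N θ),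
          lintegral_finsetSum _ fun θ _ => hm N θ]
        congr 2 with θ
        exact lintegral_dyadicKernel (fun _ => measurableSet_of_mem_grid) _ μ x

lemma lintegral_sum_dyadicOp_rpow_le {μ w : Measure (EuclideanSpace ℝ (Fin n))} {q : ℝ}
    (hq : 1 ≤ q) {B : ℝ≥0∞} (hB : ∀ (v : Fin n → ℝ) (N : ℕ),
      (∫⁻ x, dyadicOp (grid v N) (fracCoeff α) μ x ^ q ∂w) ^ (1 / q) ≤ B) (N : ℕ) :
    ∫⁻ x, (∑ θ : Fin n → Bool, dyadicOp (grid (shift N θ) N) (fracCoeff α) μ x) ^ q ∂w ≤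
      (2 ^ n * B) ^ q := by
  have hq0 : 0 < q := zero_lt_one.trans_le hq
  rw [← ENNReal.rpow_le_rpow_iff (one_div_pos.2 hq0), ← ENNReal.rpow_mul (2 ^ n * B),
    mul_one_div_cancel hq0.ne', ENNReal.rpow_one]
  calc _ ≤ ∑ θ : Fin n → Bool, _ := lintegral_rpow_finsetSum_le w
          (fun θ _ => measurable_dyadicOp (fun _ => measurableSet_of_mem_grid) _ μ) hq
    _ ≤ ∑ _θ : Fin n → Bool, B := Finset.sum_le_sum fun θ _ => hB (shift N θ) N
    _ = 2 ^ n * B := by simp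

open Filter in
lemma lintegral_fracPot_rpow_le (hn : n ≠ 0) (hα : α < n)
    {μ w : Measure (EuclideanSpace ℝ (Fin n))} {q : ℝ} (hq : 1 ≤ q) {B : ℝ≥0∞}
    (hB : ∀ (v : Fin n → ℝ) (N : ℕ),
      (∫⁻ x, dyadicOp (grid v N) (fracCoeff α) μ x ^ q ∂w) ^ (1 / q) ≤ B) :
    (∫⁻ x, fracPot α μ x ^ q ∂w) ^ (1 / q) ≤ 8 ^ (n - α) * 2 ^ n * B := by
  have hq0 : 0 < q := zero_lt_one.trans_le hq
  set U : ℕ → EuclideanSpace ℝ (Fin n) → ℝ≥0∞ := fun N x =>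
    ∑ θ : Fin n → Bool, dyadicOp (grid (shift N θ) N) (fracCoeff α) μ x
  have hU : ∀ N, Measurable fun x => U N x ^ q := fun N =>
    (Finset.measurable_sum _ fun θ _ => measurable_dyadicOp
      (fun _ => measurableSet_of_mem_grid) _ μ).pow_const q
  rw [← ENNReal.rpow_le_rpow_iff hq0, ← ENNReal.rpow_mul, one_div_mul_cancel hq0.ne',
    ENNReal.rpow_one, mul_assoc, ENNReal.mul_rpow_of_nonneg _ _ hq0.le]
  calc ∫⁻ x, fracPot α μ x ^ q ∂w
      ≤ ∫⁻ x, liminf (fun N : ℕ => (8 ^ (n - α)) ^ q * U N x ^ q) atTop ∂w := by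
        refine lintegral_mono fun x => ?_
        simp only [← ENNReal.mul_rpow_of_nonneg _ _ hq0.le]
        exact (ENNReal.rpow_le_rpow (fracPot_le_liminf hn hα μ x) hq0.le).trans_eq
          (ENNReal.orderIsoRpow q hq0).liminf_apply
    _ ≤ liminf (fun N : ℕ => ∫⁻ x, (8 ^ (n - α)) ^ q * U N x ^ q ∂w) atTop :=
        lintegral_liminf_le fun N => (hU N).const_mul _
    _ ≤ liminf (fun _ : ℕ => (8 ^ (n - α)) ^ q * (2 ^ n * B) ^ q) atTop := by
        refine liminf_le_liminf (.of_forall fun N => ?_)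
        rw [lintegral_const_mul _ (hU N)]
        gcongr
        exact lintegral_sum_dyadicOp_rpow_le hq hB N
    _ = (8 ^ (n - α)) ^ q * (2 ^ n * B) ^ q := liminf_const _

end FracPot

/-! ### Weights and the separated bump -/

section Weight

variable {n N : ℕ} {α p p' q q' : ℝ} {ε εq εp' : ℝ → ℝ} {σ w : EuclideanSpace ℝ (Fin n) → ℝ}
  {v : Fin n → ℝ} {F : Finset (Set (EuclideanSpace ℝ (Fin n)))}
  {Q T : Set (EuclideanSpace ℝ (Fin n))}

instance (σ : EuclideanSpace ℝ (Fin n) → ℝ) : SFinite (weightMeasure σ) := by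
  unfold weightMeasure
  infer_instance

lemma IsWeight.enorm_eq (hσ : IsWeight σ) (x : EuclideanSpace ℝ (Fin n)) :
    ‖σ x‖ₑ = ENNReal.ofReal (σ x) :=
  Real.enorm_of_nonneg (hσ.nonneg x)

lemma IsWeight.weightMeasure_ne_top (hσ : IsWeight σ) (hQ : Q ∈ grid v N) :
    weightMeasure σ Q ≠ ⊤ := by
  obtain ⟨a, l, -, rfl⟩ := exists_eq_cube_of_mem_grid hQ
  have hK : IsCompact ((WithLp.toLp 2 : (Fin n → ℝ) → EuclideanSpace ℝ (Fin n)) ''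
      (Set.univ.pi fun i => Icc (a i) (a i + l))) :=
    (isCompact_univ_pi fun i => isCompact_Icc).image (PiLp.continuous_toLp 2 _)
  have hsub : cube a l ⊆ (WithLp.toLp 2 : (Fin n → ℝ) → EuclideanSpace ℝ (Fin n)) ''
      (Set.univ.pi fun i => Icc (a i) (a i + l)) := fun x hx =>
    ⟨x.ofLp, fun i _ => ⟨(hx i).1, (hx i).2.le⟩, rfl⟩
  have h := ((hσ.locallyIntegrable.integrableOn_isCompact hK).mono_set hsub).2
  rw [weightMeasure, withDensity_apply _ (measurableSet_cube a l)]
  simpa only [hasFiniteIntegral_iff_enorm, hσ.enorm_eq, lt_top_iff_ne_top] using h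

lemma fracCoeff_mul_weightMeasure_le_fracMax (α : ℝ) (hσ : IsWeight σ) (hQ : Q ∈ grid v N)
    (hQT : Q ⊆ T) {x : EuclideanSpace ℝ (Fin n)} (hx : x ∈ Q) :
    fracCoeff α Q * weightMeasure σ Q ≤ fracMax α (T.indicator σ) x := by
  obtain ⟨a, l, hl, rfl⟩ := exists_eq_cube_of_mem_grid hQ
  have h : weightMeasure σ (cube a l) = ∫⁻ y in cube a l, ‖T.indicator σ y‖ₑ := by
    rw [weightMeasure, withDensity_apply _ (measurableSet_cube a l)]
    refine setLIntegral_congr_fun (measurableSet_cube a l) fun y hy => ?_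
    simp only [indicator_of_mem (hQT hy), hσ.enorm_eq]
  rw [h]
  exact le_iSup_of_le a (le_iSup_of_le l (le_iSup_of_le hl (le_iSup_of_le hx le_rfl)))

lemma varrho_ne_zero (hp : 0 < p) (hq : 0 < q) (hσ : IsWeight σ) (hQ : Q ∈ grid v N)
    (hσQ : weightMeasure σ Q ≠ 0) : varrho α p q σ Q ≠ 0 := by
  have hs : 0 < q / p := div_pos hq hp
  have hlower : ∫⁻ _ in Q, (fracCoeff α Q * weightMeasure σ Q) ^ (q / p) ≤
      ∫⁻ x in Q, fracMax α (Q.indicator σ) x ^ (q / p) := by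
    refine setLIntegral_mono' (measurableSet_of_mem_grid hQ) fun x hx => ?_
    gcongr
    exact fracCoeff_mul_weightMeasure_le_fracMax α hσ hQ subset_rfl hx
  refine ENNReal.div_ne_zero.2 ⟨fun h => ?_,
    ENNReal.rpow_ne_top_of_nonneg hs.le (hσ.weightMeasure_ne_top hQ)⟩
  rw [h, setLIntegral_const, le_zero_iff, mul_eq_zero,
    or_iff_left (nondegenerate_grid_volume v N Q hQ).1, ENNReal.rpow_eq_zero_iff_of_pos hs,
    mul_eq_zero] at hlower
  exact hlower.elim (fracCoeff_ne_zero_and_ne_top hQ α).1 hσQ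

lemma bump_le_sepBump (hp : p.HolderConjugate p') (hQ : Q ∈ grid v N) :
    (fracCoeff α Q * weightMeasure σ Q) ^ (q / p') * (weightMeasure w Q / volume Q) *
      timesBump ε (varrho α p q σ Q) ≤ sepBump α p q ε σ w := by
  obtain ⟨h0, ht⟩ := nondegenerate_grid_volume v N Q hQ
  have h : fracCoeff α Q * weightMeasure σ Q = volume Q ^ (α / n) * average σ Q := by
    rw [average, fracCoeff, ENNReal.rpow_sub _ _ h0 ht, ENNReal.rpow_one, ENNReal.mul_comm_div]
  rw [h, ← hp.conjExponent_eq]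
  obtain ⟨a, l, hl, rfl⟩ := exists_eq_cube_of_mem_grid hQ
  exact le_iSup_of_le a (le_iSup_of_le l (le_iSup_of_le hl le_rfl))

lemma varrho_ne_top (hp : p.HolderConjugate p') (hσ : IsWeight σ) (hQ : Q ∈ grid v N)
    (hσQ : weightMeasure σ Q ≠ 0) (hwQ : weightMeasure w Q ≠ 0)
    (hfin : sepBump α p q ε σ w ≠ ⊤) : varrho α p q σ Q ≠ ⊤ := by
  intro h
  have hle := bump_le_sepBump (α := α) (q := q) (σ := σ) (w := w) (ε := ε) hp hQ
  have hτ := fracCoeff_ne_zero_and_ne_top hQ α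
  have hτσ : (fracCoeff α Q * weightMeasure σ Q) ^ (q / p') ≠ 0 :=
    (ENNReal.rpow_pos (pos_iff_ne_zero.2 (mul_ne_zero hτ.1 hσQ))
      (ENNReal.mul_ne_top hτ.2 (hσ.weightMeasure_ne_top hQ))).ne'
  have hw : weightMeasure w Q / volume Q ≠ 0 :=
    ENNReal.div_ne_zero.2 ⟨hwQ, (nondegenerate_grid_volume v N Q hQ).2⟩
  rw [timesBump, if_pos h, ENNReal.mul_top (mul_ne_zero hτσ hw)] at hle
  exact hfin (top_le_iff.1 hle)

theorem testing_of_sepBump (hn : n ≠ 0) (hα : 0 < α) (hp : p.HolderConjugate p') (hpq : p ≤ q)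
    (hε : IsBumpFunction q ε) (hσ : IsWeight σ) (hF : F ⊆ grid v N)
    (hFσ : Nondegenerate F (weightMeasure σ)) (hFw : Nondegenerate F (weightMeasure w))
    (hfin : sepBump α p q ε σ w ≠ ⊤) :
    Testing F (fracCoeff α) (weightMeasure σ) (weightMeasure w) p q
      (bumpConst q ε * geomConst α * sepBump α p q ε σ w ^ (1 / q)) := by
  have hq : 0 < q := hp.pos.trans_le hpq
  have hρ : ∀ Q ∈ F, varrho α p q σ Q ≠ 0 ∧ varrho α p q σ Q ≠ ⊤ := fun Q hQ =>
    ⟨varrho_ne_zero hp.pos hq hσ (hF hQ) (hFσ Q hQ).1,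
      varrho_ne_top hp hσ (hF hQ) (hFσ Q hQ).1 (hFw Q hQ).1 hfin⟩
  refine testing_of_bump (M := fun T => fracMax α (T.indicator σ)) ((laminar_grid v N).mono hF)
    (fun Q hQ => measurableSet_of_mem_grid (hF hQ)) ((nondegenerate_grid_volume v N).mono hF) hFσ
    hp hpq (fun t => hε.pos_of_pos) (fun P hP x => dyadicOp_below_volume_le hn hα hF hP x) hρ
    (fun Q hQ => ?_) (fun T _ P hP hPT x hx =>
      fracCoeff_mul_weightMeasure_le_fracMax α hσ (hF hP) hPT hx) fun T hT => ?_
  · simpa only [timesBump, if_neg (hρ Q hQ).2] using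
      bump_le_sepBump (α := α) (q := q) (σ := σ) (w := w) (ε := ε) hp (hF hQ)
  · rw [varrho, ENNReal.div_mul_cancel
      (ENNReal.rpow_pos (pos_iff_ne_zero.2 (hFσ T hT).1) (hFσ T hT).2).ne'
      (ENNReal.rpow_ne_top_of_nonneg (div_nonneg hq.le hp.nonneg) (hFσ T hT).2)]

open Classical in
lemma dyadicOp_filter_ae_eq (F : Finset (Set X))
    (τ : Set X → ℝ≥0∞) {μ σ : Measure X} (hμ : μ ≪ σ) (w : Measure X) :
    dyadicOp (F.filter fun Q => σ Q ≠ 0 ∧ w Q ≠ 0) τ μ =ᵐ[w] dyadicOp F τ μ := by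
  have hnull : ∀ᵐ x ∂w, ∀ Q ∈ F, w Q = 0 → x ∉ Q := by
    rw [Finset.eventually_all]
    intro Q _
    by_cases h : w Q = 0
    · filter_upwards [measure_eq_zero_iff_ae_notMem.1 h] with x hx _ using hx
    · exact .of_forall fun x h' => absurd h' h
  filter_upwards [hnull] with x hx
  refine Finset.sum_filter_of_ne fun Q hQ hne => ?_
  have hxQ : x ∈ Q := mem_of_indicator_ne_zero hne
  refine ⟨fun h => hne ?_, fun h => hx Q hQ h hxQ⟩
  rw [indicator_of_mem hxQ, hμ h, mul_zero]

lemma lintegral_dyadicOp_grid_rpow_le (hn : n ≠ 0) (hα : 0 < α) (hp : p.HolderConjugate p')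
    (hq : q.HolderConjugate q') (hpq : p ≤ q) (hεq : IsBumpFunction q εq)
    (hεp' : IsBumpFunction p' εp') (hσ : IsWeight σ) (hw : IsWeight w)
    (hσw : sepBump α p q εq σ w ≠ ⊤) (hwσ : sepBump α q' p' εp' w σ ≠ ⊤)
    (v : Fin n → ℝ) (N : ℕ) {f : EuclideanSpace ℝ (Fin n) → ℝ≥0∞} (hf : Measurable f)
    (hft : ∫⁻ x, f x ^ p ∂weightMeasure σ ≠ ⊤) :
    (∫⁻ x, dyadicOp (grid v N) (fracCoeff α) ((weightMeasure σ).withDensity f) x ^ q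
        ∂weightMeasure w) ^ (1 / q) ≤
      testingConst p q * (bumpConst q εq * geomConst α * sepBump α p q εq σ w ^ (1 / q) +
        bumpConst p' εp' * geomConst α * sepBump α q' p' εp' w σ ^ (1 / p')) *
        (∫⁻ x, f x ^ p ∂weightMeasure σ) ^ (1 / p) := by
  classical
  set F := (grid v N).filter fun Q => weightMeasure σ Q ≠ 0 ∧ weightMeasure w Q ≠ 0
  have hF : F ⊆ grid v N := Finset.filter_subset _ _
  have hFσ : Nondegenerate F (weightMeasure σ) := fun Q hQ =>
    ⟨(Finset.mem_filter.1 hQ).2.1, hσ.weightMeasure_ne_top (hF hQ)⟩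
  have hFw : Nondegenerate F (weightMeasure w) := fun Q hQ =>
    ⟨(Finset.mem_filter.1 hQ).2.2, hw.weightMeasure_ne_top (hF hQ)⟩
  have hae := dyadicOp_filter_ae_eq (grid v N) (fracCoeff α)
    (withDensity_absolutelyContinuous (weightMeasure σ) f) (weightMeasure w)
  rw [lintegral_congr_ae (hae.symm.mono fun x hx => congrArg (· ^ q) hx)]
  exact lintegral_dyadicOp_rpow_le ((laminar_grid v N).mono hF)
    (fun Q hQ => measurableSet_of_mem_grid (hF hQ)) hFσ hFw
    (fun Q hQ => (fracCoeff_ne_zero_and_ne_top (hF hQ) α).2) hp hq hpq hf hft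
    (testing_of_sepBump hn hα hp hpq hεq hσ hF hFσ hFw hσw)
    (testing_of_sepBump hn hα hq.symm (holderConjugate_le_of_le hp hq hpq) hεp' hw hF hFw hFσ hwσ)

end Weight

/-! ### The fractional integral operator -/

section FracInt

variable {n : ℕ} {α p p' q q' : ℝ} {εq εp' : ℝ → ℝ} {σ w : EuclideanSpace ℝ (Fin n) → ℝ}
  {f g : EuclideanSpace ℝ (Fin n) → ℂ}

/-- The part of the norm bound that depends on the dimension and on `α`. The summand `1` makes the
bound `∞` when a separated bump is `∞`. -/
def gridConst (n : ℕ) (α : ℝ) : ℝ≥0∞ := 8 ^ (n - α) * 2 ^ n * geomConst α + 1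

/-- The part of the norm bound that depends on the exponents and on the bump functions. The summand
`1` makes the bound `∞` when a separated bump is `∞`. -/
def exponentConst (p p' q : ℝ) (εq εp' : ℝ → ℝ) : ℝ≥0∞ :=
  testingConst p q * (bumpConst q εq + bumpConst p' εp') + 1

lemma gridConst_ne_top (hα : 0 < α) (hαn : α < n) : gridConst n α ≠ ⊤ := by
  refine ENNReal.add_ne_top.2 ⟨ENNReal.mul_ne_top (ENNReal.mul_ne_top ?_ ?_)
    (geomConst_ne_top hα), ENNReal.one_ne_top⟩
  · exact ENNReal.rpow_ne_top_of_nonneg (sub_nonneg.2 hαn.le) ENNReal.ofNat_ne_top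
  · exact ENNReal.pow_ne_top ENNReal.ofNat_ne_top

lemma exponentConst_ne_top (hp : p.HolderConjugate p') (hq : 1 < q) (hεq : IsBumpFunction q εq)
    (hεp' : IsBumpFunction p' εp') : exponentConst p p' q εq εp' ≠ ⊤ :=
  ENNReal.add_ne_top.2 ⟨ENNReal.mul_ne_top (testingConst_ne_top hp.lt hq) (ENNReal.add_ne_top.2
    ⟨hεq.bumpConst_ne_top (zero_lt_one.trans hq), hεp'.bumpConst_ne_top hp.symm.pos⟩),
    ENNReal.one_ne_top⟩

/-- The right-hand side of the norm bound. -/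
def normBound (n : ℕ) (α p p' q q' : ℝ) (εq εp' : ℝ → ℝ) (σ w : EuclideanSpace ℝ (Fin n) → ℝ) :
    ℝ≥0∞ :=
  exponentConst p p' q εq εp' * gridConst n α *
    (sepBump α p q εq σ w ^ (1 / q) + sepBump α q' p' εp' w σ ^ (1 / p'))

lemma lintegral_fracPot_withDensity_rpow_le (hn : n ≠ 0) (hα : 0 < α) (hαn : α < n)
    (hp : p.HolderConjugate p') (hq : q.HolderConjugate q') (hpq : p ≤ q)
    (hεq : IsBumpFunction q εq) (hεp' : IsBumpFunction p' εp') (hσ : IsWeight σ) (hw : IsWeight w)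
    (hσw : sepBump α p q εq σ w ≠ ⊤) (hwσ : sepBump α q' p' εp' w σ ≠ ⊤)
    {f : EuclideanSpace ℝ (Fin n) → ℝ≥0∞} (hf : AEMeasurable f (weightMeasure σ))
    (hft : ∫⁻ x, f x ^ p ∂weightMeasure σ ≠ ⊤) :
    (∫⁻ x, fracPot α ((weightMeasure σ).withDensity f) x ^ q ∂weightMeasure w) ^ (1 / q) ≤
      normBound n α p p' q q' εq εp' σ w * (∫⁻ x, f x ^ p ∂weightMeasure σ) ^ (1 / p) := by
  wlog hfm : Measurable f generalizing f
  · have hrpow := lintegral_congr_ae (hf.ae_eq_mk.mono fun x hx => congrArg (· ^ p) hx)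
    simp only [withDensity_congr_ae hf.ae_eq_mk, hrpow]
    exact this hf.measurable_mk.aemeasurable (hrpow ▸ hft) hf.measurable_mk
  refine (lintegral_fracPot_rpow_le hn hαn hq.lt.le fun v N =>
    lintegral_dyadicOp_grid_rpow_le hn hα hp hq hpq hεq hεp' hσ hw hσw hwσ v N hfm hft).trans ?_
  rw [← mul_assoc, normBound]
  gcongr ?_ * _
  set A := sepBump α p q εq σ w ^ (1 / q)
  set B := sepBump α q' p' εp' w σ ^ (1 / p')
  calc 8 ^ (n - α) * 2 ^ n * (testingConst p q *
        (bumpConst q εq * geomConst α * A + bumpConst p' εp' * geomConst α * B))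
      ≤ 8 ^ (n - α) * 2 ^ n * (testingConst p q *
        ((bumpConst q εq + bumpConst p' εp') * geomConst α * A +
          (bumpConst q εq + bumpConst p' εp') * geomConst α * B)) := by
        gcongr
        · exact le_self_add
        · exact le_add_self
    _ = testingConst p q * (bumpConst q εq + bumpConst p' εp') *
        (8 ^ (n - α) * 2 ^ n * geomConst α) * (A + B) := by ring
    _ ≤ exponentConst p p' q εq εp' * gridConst n α * (A + B) := by
        gcongr
        · exact le_self_add
        · exact le_self_add

lemma enorm_complex_ofReal (r : ℝ) : ‖(r : ℂ)‖ₑ = ‖r‖ₑ :=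
  congrArg ENNReal.ofNNReal (Complex.nnnorm_real r)

lemma enorm_fracKernel (α : ℝ) (g : EuclideanSpace ℝ (Fin n) → ℂ)
    (x y : EuclideanSpace ℝ (Fin n)) : ‖fracKernel α g x y‖ₑ = ‖g y‖ₑ * potKernel α x y := by
  have h : 0 ≤ ‖y - x‖ ^ ((n : ℝ) - α) := Real.rpow_nonneg (norm_nonneg _) _
  rw [fracKernel, div_eq_mul_inv, enorm_mul, ← Complex.ofReal_inv, enorm_complex_ofReal,
    Real.enorm_of_nonneg (inv_nonneg.2 h), potKernel]

lemma lintegral_enorm_fracKernel (hg : AEStronglyMeasurable g volume)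
    (x : EuclideanSpace ℝ (Fin n)) :
    ∫⁻ y, ‖fracKernel α g x y‖ₑ = fracPot α (volume.withDensity fun y => ‖g y‖ₑ) x := by
  have hk : Measurable (potKernel α x) := (measurable_uncurry_potKernel α).of_uncurry_left
  rw [fracPot, lintegral_withDensity_eq_lintegral_mul₀ hg.enorm hk.aemeasurable]
  simp only [enorm_fracKernel, Pi.mul_apply]

lemma aestronglyMeasurable_fracKernel (hg : AEStronglyMeasurable g volume)
    (x : EuclideanSpace ℝ (Fin n)) : AEStronglyMeasurable (fracKernel α g x) volume := by
  have := hg.aemeasurable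
  unfold fracKernel
  exact AEMeasurable.aestronglyMeasurable (by fun_prop)

lemma aestronglyMeasurable_fracInt (hg : AEStronglyMeasurable g volume)
    (ν : Measure (EuclideanSpace ℝ (Fin n))) [SFinite ν] :
    AEStronglyMeasurable (fracInt α g) ν := by
  have : AEMeasurable (fun z : EuclideanSpace ℝ (Fin n) × EuclideanSpace ℝ (Fin n) => g z.2)
      (ν.prod volume) := hg.aemeasurable.comp_snd
  refine AEStronglyMeasurable.integral_prod_right' (f := Function.uncurry (fracKernel α g)) ?_
  unfold Function.uncurry fracKernel
  exact AEMeasurable.aestronglyMeasurable (by fun_prop)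

lemma IsWeight.aestronglyMeasurable_mul (hσ : IsWeight σ)
    (hf : AEStronglyMeasurable f (weightMeasure σ)) :
    AEStronglyMeasurable (fun y => (σ y : ℂ) * f y) volume := by
  have hσm := hσ.locallyIntegrable.aestronglyMeasurable
  have hff : ∀ᵐ y, ENNReal.ofReal (σ y) ≠ 0 → f y = hf.mk f y :=
    (ae_withDensity_iff' hσm.aemeasurable.ennreal_ofReal).1 hf.ae_eq_mk
  refine AEStronglyMeasurable.congr (f := fun y => (σ y : ℂ) * hf.mk f y)
    ((Complex.continuous_ofReal.comp_aestronglyMeasurable hσm).mul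
      hf.stronglyMeasurable_mk.aestronglyMeasurable) ?_
  filter_upwards [hff] with y hy
  rcases (hσ.nonneg y).eq_or_lt with h0 | h0
  · simp [← h0]
  · rw [hy (ENNReal.ofReal_pos.2 h0).ne']

lemma IsWeight.withDensity_enorm_mul (hσ : IsWeight σ)
    (hf : AEStronglyMeasurable f (weightMeasure σ)) :
    volume.withDensity (fun y => ‖(σ y : ℂ) * f y‖ₑ) =
      (weightMeasure σ).withDensity fun y => ‖f y‖ₑ := by
  have hσm := hσ.locallyIntegrable.aestronglyMeasurable.aemeasurable.ennreal_ofReal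
  ext s hs
  rw [withDensity_apply _ hs, withDensity_apply _ hs, weightMeasure,
    setLIntegral_withDensity_eq_lintegral_mul₀' hσm hf.enorm hs]
  simp only [enorm_mul, enorm_complex_ofReal, hσ.enorm_eq, Pi.mul_apply]

lemma isBound_of_fracPot (hp : 0 < p) (hq : 0 < q) (hσ : IsWeight σ) {B : ℝ≥0∞} (hB : B ≠ ⊤)
    (h : ∀ f : EuclideanSpace ℝ (Fin n) → ℝ≥0∞, AEMeasurable f (weightMeasure σ) →
      ∫⁻ x, f x ^ p ∂weightMeasure σ ≠ ⊤ →
      (∫⁻ x, fracPot α ((weightMeasure σ).withDensity f) x ^ q ∂weightMeasure w) ^ (1 / q) ≤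
        B * (∫⁻ x, f x ^ p ∂weightMeasure σ) ^ (1 / p)) :
    IsBound α p q σ w B := by
  intro f hf
  set g : EuclideanSpace ℝ (Fin n) → ℂ := fun y => (σ y : ℂ) * f y
  have hg : AEStronglyMeasurable g volume := hσ.aestronglyMeasurable_mul hf.1
  set P := fracPot α (volume.withDensity fun y => ‖g y‖ₑ)
  have hgP : ∀ x, ∫⁻ y, ‖fracKernel α g x y‖ₑ = P x := lintegral_enorm_fracKernel hg
  have hLp : eLpNorm f (ENNReal.ofReal p) (weightMeasure σ) =
      (∫⁻ x, ‖f x‖ₑ ^ p ∂weightMeasure σ) ^ (1 / p) := by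
    rw [eLpNorm_eq_lintegral_rpow_enorm_toReal (ENNReal.ofReal_pos.2 hp).ne' ENNReal.ofReal_ne_top,
      ENNReal.toReal_ofReal hp.le]
  have hft : ∫⁻ x, ‖f x‖ₑ ^ p ∂weightMeasure σ ≠ ⊤ := by
    have := hf.2.ne
    rwa [hLp, Ne, ENNReal.rpow_eq_top_iff_of_pos (one_div_pos.2 hp)] at this
  have hPB : (∫⁻ x, P x ^ q ∂weightMeasure w) ^ (1 / q) ≤
      B * eLpNorm f (ENNReal.ofReal p) (weightMeasure σ) := by
    simp only [P, g, hσ.withDensity_enorm_mul hf.1, hLp]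
    exact h _ hf.1.enorm hft
  refine ⟨?_, aestronglyMeasurable_fracInt hg _, le_trans ?_ hPB⟩
  · have hPt : ∫⁻ x, P x ^ q ∂weightMeasure w ≠ ⊤ := by
      have := ne_top_of_le_ne_top (ENNReal.mul_ne_top hB hf.2.ne) hPB
      rwa [Ne, ENNReal.rpow_eq_top_iff_of_pos (one_div_pos.2 hq)] at this
    filter_upwards [ae_lt_top ((measurable_fracPot α _).pow_const q) hPt] with x hx
    refine ⟨aestronglyMeasurable_fracKernel hg x, ?_⟩
    rwa [hasFiniteIntegral_iff_enorm, hgP, ← ENNReal.rpow_lt_top_iff_of_pos hq]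
  · rw [eLpNorm_eq_lintegral_rpow_enorm_toReal (ENNReal.ofReal_pos.2 hq).ne' ENNReal.ofReal_ne_top,
      ENNReal.toReal_ofReal hq.le]
    gcongr with x
    exact (enorm_integral_le_lintegral_enorm _).trans_eq (hgP x)

theorem fracIntNorm_le_normBound (hα : 0 < α) (hαn : α < n) (hp : p.HolderConjugate p')
    (hq : q.HolderConjugate q') (hpq : p ≤ q) (hεq : IsBumpFunction q εq)
    (hεp' : IsBumpFunction p' εp') (hσ : IsWeight σ) (hw : IsWeight w) :
    fracIntNorm α p q σ w ≤ normBound n α p p' q q' εq εp' σ w := by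
  have hn : n ≠ 0 := by
    rintro rfl
    exact (hα.trans hαn).ne' Nat.cast_zero
  rcases eq_or_ne (normBound n α p p' q q' εq εp' σ w) ⊤ with h | h
  · exact h ▸ le_top
  have hbump : sepBump α p q εq σ w ^ (1 / q) + sepBump α q' p' εp' w σ ^ (1 / p') ≠ ⊤ := by
    refine fun htop => h ?_
    rw [normBound, htop, ENNReal.mul_top]
    simp [exponentConst, gridConst]
  rw [ENNReal.add_ne_top, Ne, Ne, ENNReal.rpow_eq_top_iff_of_pos hq.one_div_pos,
    ENNReal.rpow_eq_top_iff_of_pos hp.symm.one_div_pos] at hbump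
  exact sInf_le (isBound_of_fracPot hp.pos hq.pos hσ h fun f hf hft =>
    lintegral_fracPot_withDensity_rpow_le hn hα hαn hp hq hpq hεq hεp' hσ hw hbump.1 hbump.2 hf hft)

end FracInt

end SepBump

end

theorem theorem1p4 :
    ∃ C : ℕ → ℝ → ℝ≥0, ∀ (p q : ℝ), 1 < p → p ≤ q → ∀ (εq εp' : ℝ → ℝ),
      SepBump.IsBumpFunction q εq → SepBump.IsBumpFunction p.conjExponent εp' →
      ∃ K : ℝ≥0, ∀ (n : ℕ) (α : ℝ), 0 < α → α < n →
        ∀ (σ w : EuclideanSpace ℝ (Fin n) → ℝ), SepBump.IsWeight σ → SepBump.IsWeight w →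
          SepBump.fracIntNorm α p q σ w ≤
            (K : ℝ≥0∞) * (C n α : ℝ≥0∞) *
              (SepBump.sepBump α p q εq σ w ^ (1 / q) +
                SepBump.sepBump α q.conjExponent p.conjExponent εp' w σ
                  ^ (1 / p.conjExponent)) := by
  refine ⟨fun n α => (SepBump.gridConst n α).toNNReal,
    fun p q hp1 hpq εq εp' hεq hεp' => ?_⟩
  have hp := Real.HolderConjugate.conjExponent hp1
  have hq := Real.HolderConjugate.conjExponent (hp1.trans_le hpq)
  refine ⟨(SepBump.exponentConst p p.conjExponent q εq εp').toNNReal,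
    fun n α hα hαn σ w hσ hw => ?_⟩
  rw [ENNReal.coe_toNNReal (SepBump.exponentConst_ne_top hp hq.lt hεq hεp'),
    ENNReal.coe_toNNReal (SepBump.gridConst_ne_top hα hαn)]
  exact SepBump.fracIntNorm_le_normBound hα hαn hp hq hpq hεq hεp' hσ hw
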